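/- **Lemma 2.3.** Let $d,n,N\ge 1$ be integers. Let $\mathcal R_N$ be the set of functions $V:\mathbb Z^d\to\mathbb R^{n\times n}$ such that $V_{lk}(-z)=V_{kl}(z)$ for all $z\in\mathbb Z^d$ and $1\le k,l\le n$, and $V(x)=0$ whenever $\max_i|x_i|>N$; this is a finite-dimensional real vector space with its usual topology. For $V\in\mathcal R_N$ let $\hat V(\theta)=\sum_{z\in\mathbb Z^d}V(z)e^{iz\cdot\theta}$, a Hermitian matrix-valued function on $\mathbb T^d=\mathbb R^d/2\pi\mathbb Z^d$. By a *choice of dispersion relations* of $V$ we mean a closed set $\mathcal C_*\subset\mathbb T^d$ of Lebesgue measure zero together with real-analytic functions $\omega_1,\dots,\omega_n:\mathbb T^d\setminus\mathcal C_*\to\mathbb C$ such that, for every $\theta\in\mathbb T^d\setminus\mathcal C_*$, $\omega_1(\theta),\dots,\omega_n(\theta)$ are the eigenvalues, counted with multiplicity, of the principal square root $\Omega(\theta)=\hat V(\theta)^{1/2}$, and such that for all $k,l$ either $\omega_k=\omega_l$ everywhere on $\mathbb T^d\setminus\mathcal C_*$ or $\omega_k\ne\omega_l$ everywhere on $\mathbb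 T^d\setminus\mathcal C_*$. (The principal square root of an eigenvalue $\lambda$ of $\hat V(\theta)$ is $\sqrt\lambda\ge 0$ if $\lambda\ge0$, and $i\sqrt{|\lambda|}$ if $\lambda<0$.) Then there is an open dense subset $G\subset\mathcal R_N$ such that every $V\in G$ admits a choice of dispersion relations, and for every such choice $(\mathcal C_*,\omega_1,\dots,\omega_n)$ the following hold. * **E4.** For each $k$, the function $D_k(\theta)=\det\Big(\dfrac{\partial^2\omega_k(\theta)}{\partial\theta_i\,\partial\theta_j}\Big)_{i,j=1}^d$ is not identically zero on $\mathbb T^d\setminus\mathcal C_*$. * **E5.** For all $k\ne l$, neither $\omega_k-\omega_l$ nor $\omega_k+\omega_l$ is identically equal to a nonzero constant on $\mathbb T^d\setminus\mathcal C_*$. -/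

import Mathlib

open MeasureTheory

namespace HarmonicCrystal

/-- Matrix-valued functions `V` on the lattice `ℤ^d` with real `n × n` matrices as values.
The topology is the product topology (pointwise convergence of all entries). -/
abbrev Interaction (d n : ℕ) : Type := (Fin d → ℤ) → Matrix (Fin n) (Fin n) ℝ

/-- The symmetry condition (E2): `V_{lk}(-z) = V_{kl}(z)`. -/
def CondE2 {d n : ℕ} (V : Interaction d n) : Prop :=
  ∀ (z : Fin d → ℤ) (k l : Fin n), V (-z) l k = V z k l

/-- The set `R_N` of symmetric interaction matrices with `V(x) = 0` for `max_i |x_i| > N`.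
It is a finite-dimensional linear subspace, so the topology which it inherits from
`Interaction d n` is that of its identification with some `ℝ^M`. -/
def FiniteRange (d n N : ℕ) : Set (Interaction d n) :=
  {V | CondE2 V ∧ ∀ x : Fin d → ℤ, (∃ i, (N : ℤ) < |x i|) → V x = 0}

/-- The Fourier transform `V̂_{kl}(θ) = ∑_z V_{kl}(z) e^{i z·θ}`. Functions on the torus
`ℝ^d / 2πℤ^d` are regarded throughout as `2πℤ^d`-periodic functions on `ℝ^d`. -/
noncomputable def vHat {d n : ℕ} (V : Interaction d n) (θ : Fin d → ℝ) :
    Matrix (Fin n) (Fin n) ℂ :=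
  Matrix.of fun k l =>
    ∑' z : Fin d → ℤ, (V z k l : ℂ) * Complex.exp (Complex.I * ∑ i, (z i : ℂ) * (θ i : ℂ))

/-- Translation by the period `2πm`, `m ∈ ℤ^d`. -/
noncomputable def periodShift {d : ℕ} (m : Fin d → ℤ) (θ : Fin d → ℝ) : Fin d → ℝ :=
  fun i => θ i + 2 * Real.pi * (m i : ℝ)

/-- `IsDispersion V C ω`: `C` is an admissible exceptional set (crossing points and other
singularities) and `ω_1, …, ω_n` are the dispersion relations of `V`, i.e. the eigenvalues of
`Ω(θ) = V̂(θ)^{1/2}` counted with multiplicity, enumerated real-analytically off `C`. -/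
structure IsDispersion {d n : ℕ} (V : Interaction d n) (C : Set (Fin d → ℝ))
    (ω : Fin n → (Fin d → ℝ) → ℂ) : Prop where
  /-- `C` is closed, periodic (a closed subset of the torus), and of measure zero. -/
  isClosed : IsClosed C
  periodic : ∀ θ ∈ C, ∀ m : Fin d → ℤ, periodShift m θ ∈ C
  null : volume C = 0
  /-- The `ω_k` are periodic (functions on the torus minus `C`). -/
  periodic_omega : ∀ k, ∀ θ ∉ C, ∀ m : Fin d → ℤ, ω k (periodShift m θ) = ω k θ
  /-- The Hermitian matrix `V̂(θ)` is the square of `Ω = B diag(ω_1, …, ω_n) B^*` for some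
  unitary `B`. -/
  diag : ∀ θ ∉ C, ∃ B ∈ Matrix.unitaryGroup (Fin n) ℂ,
    vHat V θ = (B * Matrix.diagonal (fun k => ω k θ) * B.conjTranspose) ^ 2
  /-- The square root is the principal one: since `ω_k²` is real, `ω_k` lies in `[0, ∞)` if the
  eigenvalue `ω_k²` of `V̂` is nonnegative, and in `i (0, ∞)` if it is negative. -/
  principal : ∀ k, ∀ θ ∉ C, 0 ≤ (ω k θ).re ∧ 0 ≤ (ω k θ).im
  /-- The `ω_k` are real-analytic off `C`. -/
  analytic : ∀ k, AnalyticOnNhd ℝ (ω k) Cᶜ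
  /-- Constant multiplicity: two dispersion relations agree everywhere off `C`, or nowhere. -/
  multiplicity : ∀ k l, (∀ θ ∉ C, ω k θ = ω l θ) ∨ (∀ θ ∉ C, ω k θ ≠ ω l θ)

/-- The partial derivative `∂f/∂θ_i`. -/
noncomputable def partialDeriv {d : ℕ} (i : Fin d) (f : (Fin d → ℝ) → ℂ)
    (θ : Fin d → ℝ) : ℂ :=
  fderiv ℝ f θ (Pi.single i 1)

/-- The Hessian determinant `det (∂²f / ∂θ_i ∂θ_j)`. -/
noncomputable def hessDet {d : ℕ} (f : (Fin d → ℝ) → ℂ) (θ : Fin d → ℝ) : ℂ :=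
  Matrix.det (Matrix.of fun i j : Fin d => partialDeriv i (partialDeriv j f) θ)

/-- Condition (E4), for every admissible choice of the exceptional set and of the
enumeration of the dispersion relations: no Hessian determinant `D_k` vanishes identically. -/
def CondE4 {d n : ℕ} (V : Interaction d n) : Prop :=
  ∀ (C : Set (Fin d → ℝ)) (ω : Fin n → (Fin d → ℝ) → ℂ), IsDispersion V C ω →
    ∀ k, ∃ θ, θ ∉ C ∧ hessDet (ω k) θ ≠ 0

/-- Condition (E5), for every admissible choice of the exceptional set and of the
enumeration of the dispersion relations: for `k ≠ l` neither `ω_k - ω_l` nor `ω_k + ω_l` is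
identically equal to a nonzero constant. -/
def CondE5 {d n : ℕ} (V : Interaction d n) : Prop :=
  ∀ (C : Set (Fin d → ℝ)) (ω : Fin n → (Fin d → ℝ) → ℂ), IsDispersion V C ω →
    ∀ k l, k ≠ l → ∀ c : ℂ, c ≠ 0 →
      (¬ ∀ θ, θ ∉ C → ω k θ - ω l θ = c) ∧ (¬ ∀ θ, θ ∉ C → ω k θ + ω l θ = c)

end HarmonicCrystal

/-! Order the eigenvalues of the Hermitian symbol and take principal square roots: this gives the
branches `branch`. They are analytic jointly in coefficients and momentum wherever `simpleDisc`
(discriminant times determinant) is nonzero, since simple roots obey the implicit function theorem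
(`analyticAt_eig`) and the square root is analytic off zero. One such momentum makes the zero set of
`simpleDisc` null, which yields a choice of dispersion relations.

For any choice, the exceptional set is null and the relations are locally a permutation of the
branches (`exists_local_permutation`). Hence E4 follows from one momentum with nonzero Hessian
determinants, and E5 from one momentum where the `i`-th derivatives of distinct branches are neither
equal nor opposite. Both conditions are open in (coefficients, momentum), and projection to
coefficients is open.

For density, first move along a segment towards a constant symbol with simple nonzero spectrum. Then
add `ε (a - ∑ cos θ_i)` times the identity, which shifts every `ω_k²` equally. Where this function
vanishes to first order with identity Hessian, the Hessian of `ω_k` gains `ε/(2ω_k)` times the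
identity; where it vanishes with nonzero gradient, `∂_i ω_k` gains `ε/(2ω_k)`. Small `ε ≠ 0` then
avoids all degeneracies. -/

namespace HarmonicCrystal

open Filter Topology

/-! ### Ordered eigenvalues and the discriminant -/

/-- The ordered eigenvalues of a Hermitian matrix (zero if the matrix is not Hermitian). -/
noncomputable def eig {n : ℕ} (A : Matrix (Fin n) (Fin n) ℂ) (k : Fin n) : ℝ :=
  open Classical in if h : A.IsHermitian then h.eigenvalues k else 0

theorem charpoly_eq_prod_eig {n : ℕ} {A : Matrix (Fin n) (Fin n) ℂ} (hA : A.IsHermitian) :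
    A.charpoly = ∏ k, (Polynomial.X - Polynomial.C (eig A k : ℂ)) := by
  have := hA.charpoly_eq
  simpa [eig, hA] using this

theorem exists_unitary_eig {n : ℕ} {A : Matrix (Fin n) (Fin n) ℂ} (hA : A.IsHermitian) :
    ∃ U ∈ Matrix.unitaryGroup (Fin n) ℂ,
      A = U * Matrix.diagonal (fun k => (eig A k : ℂ)) * U.conjTranspose := by
  refine ⟨hA.eigenvectorUnitary, hA.eigenvectorUnitary.2, ?_⟩
  have := hA.spectral_theorem
  rw [Unitary.conjStarAlgAut_apply] at this
  have h2 : (fun k => (eig A k : ℂ)) = (RCLike.ofReal ∘ hA.eigenvalues : Fin n → ℂ) := by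
    ext k; simp [eig, hA]
  rw [h2]
  exact this

theorem unitary_conj_pow {n : ℕ} {U : Matrix (Fin n) (Fin n) ℂ}
    (hU : U ∈ Matrix.unitaryGroup (Fin n) ℂ) (D : Matrix (Fin n) (Fin n) ℂ) (m : ℕ) :
    (U * D * U.conjTranspose) ^ m = U * D ^ m * U.conjTranspose := by
  have h1 : U.conjTranspose * U = 1 := Matrix.mem_unitaryGroup_iff'.1 hU
  have h2 : U * U.conjTranspose = 1 := Matrix.mem_unitaryGroup_iff.1 hU
  induction m with
  | zero => simp [h2]
  | succ m ih =>
    rw [pow_succ, ih, pow_succ]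
    calc U * D ^ m * U.conjTranspose * (U * D * U.conjTranspose)
        = U * D ^ m * (U.conjTranspose * U) * D * U.conjTranspose := by
          simp only [Matrix.mul_assoc]
      _ = _ := by rw [h1]; simp only [Matrix.mul_assoc, Matrix.mul_one]

theorem trace_unitary_conj {n : ℕ} {U : Matrix (Fin n) (Fin n) ℂ}
    (hU : U ∈ Matrix.unitaryGroup (Fin n) ℂ) (D : Matrix (Fin n) (Fin n) ℂ) :
    (U * D * U.conjTranspose).trace = D.trace := by
  have h1 : U.conjTranspose * U = 1 := Matrix.mem_unitaryGroup_iff'.1 hU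
  rw [Matrix.trace_mul_comm, ← Matrix.mul_assoc, h1, Matrix.one_mul]

/-- The discriminant of the characteristic polynomial, as a Hankel determinant of the traces of
powers. -/
noncomputable def traceDisc {n : ℕ} (A : Matrix (Fin n) (Fin n) ℂ) : ℂ :=
  (Matrix.of fun i j : Fin n => (A ^ ((i : ℕ) + (j : ℕ))).trace).det

/-- Traces of powers are power sums of the eigenvalues, so the Hankel matrix is a Vandermonde matrix
transposed times itself. Being polynomial in the entries, it stays analytic where eigenvalues cross.
-/
theorem traceDisc_ne_zero_iff {n : ℕ} {A : Matrix (Fin n) (Fin n) ℂ} (hA : A.IsHermitian) :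
    traceDisc A ≠ 0 ↔ Function.Injective (eig A) := by
  obtain ⟨U, hU, hAU⟩ := exists_unitary_eig hA
  have h1 : (Matrix.of fun i j : Fin n => (A ^ ((i : ℕ) + (j : ℕ))).trace) =
      (Matrix.vandermonde (fun k => (eig A k : ℂ))).transpose *
        Matrix.vandermonde (fun k => (eig A k : ℂ)) := by
    ext i j
    rw [Matrix.vandermonde_transpose_mul_vandermonde, Matrix.of_apply]
    conv_lhs => rw [hAU]
    rw [unitary_conj_pow hU, trace_unitary_conj hU, Matrix.diagonal_pow, Matrix.trace_diagonal]
    rfl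
  rw [traceDisc, h1, Matrix.det_mul, Matrix.det_transpose, mul_self_ne_zero,
    Matrix.det_vandermonde_ne_zero_iff]
  exact ⟨fun h k l hkl => h (by simp [hkl]), fun h k l hkl => h (Complex.ofReal_injective hkl)⟩

theorem det_ne_zero_iff_eig {n : ℕ} {A : Matrix (Fin n) (Fin n) ℂ} (hA : A.IsHermitian) :
    A.det ≠ 0 ↔ ∀ k, eig A k ≠ 0 := by
  have : A.det = ∏ k, (eig A k : ℂ) := by
    rw [hA.det_eq_prod_eigenvalues]; simp [eig, hA]
  rw [this, Finset.prod_ne_zero_iff]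
  simp

/-- A reindexing making the eigenvalues decreasing. -/
theorem exists_equiv_eig_antitone (n : ℕ) : ∃ e : Fin n ≃ Fin n,
    ∀ A : Matrix (Fin n) (Fin n) ℂ, Antitone (fun i => eig A (e i)) := by
  -- `eigenvalues` is the decreasing `eigenvalues₀` composed with a fixed reindexing; undoing that
  -- reindexing works for all matrices at once.
  refine ⟨(finCongr (Fintype.card_fin n).symm).trans
    (Fintype.equivOfCardEq (Fintype.card_fin _)), fun A => ?_⟩
  by_cases hA : A.IsHermitian
  · intro i j hij
    simp only [eig, hA, dif_pos, Matrix.IsHermitian.eigenvalues, Equiv.trans_apply,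
      Equiv.symm_apply_apply]
    exact hA.eigenvalues₀_antitone (by simpa using hij)
  · intro i j _
    simp [eig, hA]

/-! ### Analytic dependence of simple eigenvalues -/

section Analytic

variable {E : Type*} [NormedAddCommGroup E] [NormedSpace ℝ E]

theorem analyticAt_det {ι : Type*} [Fintype ι] [DecidableEq ι] {A : E → Matrix ι ι ℂ} {x : E}
    (hA : ∀ i j, AnalyticAt ℝ (fun y => A y i j) x) : AnalyticAt ℝ (fun y => (A y).det) x := by
  simp only [Matrix.det_apply]
  refine Finset.analyticAt_fun_sum _ fun σ _ => ?_
  have : AnalyticAt ℝ (fun y => ∏ i, A y (σ i) i) x :=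
    Finset.analyticAt_fun_prod _ fun i _ => hA _ _
  simp only [Units.smul_def, zsmul_eq_mul]
  exact analyticAt_const.mul this

theorem analyticAt_matrix_pow {n : ℕ} {A : E → Matrix (Fin n) (Fin n) ℂ} {x : E}
    (hA : ∀ i j, AnalyticAt ℝ (fun y => A y i j) x) (m : ℕ) :
    ∀ i j, AnalyticAt ℝ (fun y => (A y ^ m) i j) x := by
  induction m with
  | zero => intro i j; simpa using analyticAt_const
  | succ m ih =>
    intro i j
    simp only [pow_succ, Matrix.mul_apply]
    exact Finset.analyticAt_fun_sum _ fun k _ => (ih i k).mul (hA k j)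

theorem analyticAt_traceDisc {n : ℕ} {A : E → Matrix (Fin n) (Fin n) ℂ} {x : E}
    (hA : ∀ i j, AnalyticAt ℝ (fun y => A y i j) x) :
    AnalyticAt ℝ (fun y => traceDisc (A y)) x := by
  refine analyticAt_det fun i j => ?_
  simp only [Matrix.of_apply, Matrix.trace, Matrix.diag_apply]
  exact Finset.analyticAt_fun_sum _ fun k _ => analyticAt_matrix_pow hA _ k k

theorem analyticAt_ofReal {f : E → ℝ} {x : E} (hf : AnalyticAt ℝ f x) :
    AnalyticAt ℝ (fun y => (f y : ℂ)) x :=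
  (Complex.ofRealCLM.analyticAt _).comp hf

theorem analyticAt_re {f : E → ℂ} {x : E} (hf : AnalyticAt ℝ f x) :
    AnalyticAt ℝ (fun y => (f y).re) x :=
  (Complex.reCLM.analyticAt _).comp hf

/-- Simple real roots of an analytic family of real equations depend analytically on the
parameters. -/
theorem exists_analytic_root [CompleteSpace E] {F : E × ℝ → ℝ} {x : E} {y c : ℝ}
    (hF : AnalyticAt ℝ F (x, y)) (h0 : F (x, y) = 0)
    (hd : HasDerivAt (fun t => F (x, t)) c y) (hc : c ≠ 0) :
    ∃ r : E → ℝ, AnalyticAt ℝ r x ∧ r x = y ∧ ∀ᶠ z in 𝓝 x, F (z, r z) = 0 := by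
  -- Here `⊤` means analytic rather than smooth, so the implicit function is analytic too.
  have cdf : ContDiffAt ℝ ⊤ F (x, y) := hF.contDiffAt
  have pn : (⊤ : WithTop ℕ∞) ≠ 0 := by simp
  have hdF : HasFDerivAt F (fderiv ℝ F (x, y)) (x, y) := hF.differentiableAt.hasFDerivAt
  have hcomp : HasDerivAt (fun t => F (x, t)) (fderiv ℝ F (x, y) (0, 1)) y :=
    hdF.comp_hasDerivAt y ((hasDerivAt_const y x).prodMk (hasDerivAt_id y))
  have hval : fderiv ℝ F (x, y) (0, 1) = c := hcomp.unique hd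
  have inv : (fderiv ℝ F (x, y) ∘L .inr ℝ E ℝ).IsInvertible := by
    refine ⟨ContinuousLinearEquiv.unitsEquivAut ℝ (Units.mk0 c hc), ?_⟩
    ext
    simp [hval]
  refine ⟨cdf.implicitFunction pn inv, ?_, cdf.implicitFunction_apply_self pn inv, ?_⟩
  · have := cdf.contDiffAt_implicitFunction pn inv
    exact this.analyticAt
  · have := cdf.eventually_apply_implicitFunction pn inv
    simpa [h0] using this

/-- The `n` distinct roots `r k` exhaust the spectrum, and a finite set has only one strictly
decreasing enumeration. This identifies locally constructed roots with the ordered eigenvalues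
without knowing beforehand that the latter are continuous. -/
theorem eig_eq_of_antitone_roots {n : ℕ} {A : Matrix (Fin n) (Fin n) ℂ} (hA : A.IsHermitian)
    {e : Fin n ≃ Fin n} (he : Antitone (fun i => eig A (e i))) {r : Fin n → ℝ}
    (hr : StrictAnti (fun i => r (e i))) (hroot : ∀ k, A.charpoly.eval (r k : ℂ) = 0) :
    eig A = r := by
  have h1 : ∀ k, ∃ l, r k = eig A l := by
    intro k
    have := hroot k
    rw [charpoly_eq_prod_eig hA, Polynomial.eval_prod, Finset.prod_eq_zero_iff] at this
    obtain ⟨l, -, hl⟩ := this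
    refine ⟨l, ?_⟩
    rw [Polynomial.eval_sub, Polynomial.eval_X, Polynomial.eval_C, sub_eq_zero] at hl
    exact_mod_cast hl
  choose σ hσ using h1
  have hrinj : Function.Injective r := by
    intro k l hkl
    have := hr.injective (a₁ := e.symm k) (a₂ := e.symm l) (by simpa using hkl)
    simpa using this
  have hσinj : Function.Injective σ := fun k l hkl => hrinj (by rw [hσ, hσ, hkl])
  have hσbij := Finite.injective_iff_bijective.1 hσinj
  have hinj : Function.Injective (eig A) := by
    intro k l hkl
    obtain ⟨k', rfl⟩ := hσbij.2 k
    obtain ⟨l', rfl⟩ := hσbij.2 l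
    rw [← hσ, ← hσ] at hkl
    rw [hrinj hkl]
  have hs : StrictAnti (fun i => eig A (e i)) :=
    he.strictAnti_of_injective (hinj.comp e.injective)
  have hrange : Set.range (fun i => - eig A (e i)) = Set.range (fun i => - r (e i)) := by
    ext t
    constructor
    · rintro ⟨i, rfl⟩
      obtain ⟨k, hk⟩ := hσbij.2 (e i)
      exact ⟨e.symm k, by simp [hσ, hk]⟩
    · rintro ⟨i, rfl⟩
      exact ⟨e.symm (σ (e i)), by simp [hσ]⟩
  have hf : (fun i => - eig A (e i)) = (fun i => - r (e i)) :=
    (StrictMono.range_inj (fun i j h => neg_lt_neg (hs h)) (fun i j h => neg_lt_neg (hr h))).1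
      hrange
  funext k
  have := congrFun hf (e.symm k)
  simpa using this

/-- The implicit function theorem continues each simple root analytically. The strict order at `x`
persists nearby, which forces the continued roots to be the ordered eigenvalues. -/
theorem analyticAt_eig [CompleteSpace E] {n : ℕ} {A : E → Matrix (Fin n) (Fin n) ℂ} {x : E}
    (hH : ∀ y, (A y).IsHermitian) (hA : ∀ i j, AnalyticAt ℝ (fun y => A y i j) x)
    (hinj : Function.Injective (eig (A x))) (k : Fin n) :
    AnalyticAt ℝ (fun y => eig (A y) k) x := by
  obtain ⟨e, he⟩ := exists_equiv_eig_antitone n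
  let F : E × ℝ → ℝ := fun q => ((A q.1).charpoly.eval (q.2 : ℂ)).re
  have hFprod : ∀ q : E × ℝ, F q = ∏ l, (q.2 - eig (A q.1) l) := by
    intro q
    have : (A q.1).charpoly.eval (q.2 : ℂ) = ((∏ l, (q.2 - eig (A q.1) l) : ℝ) : ℂ) := by
      rw [charpoly_eq_prod_eig (hH _), Polynomial.eval_prod]
      simp
    simp only [F, this, Complex.ofReal_re]
  have hFan : ∀ t : ℝ, AnalyticAt ℝ F (x, t) := by
    intro t
    refine analyticAt_re ?_
    simp only [Matrix.eval_charpoly]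
    refine analyticAt_det fun i j => ?_
    have h1 : AnalyticAt ℝ (fun q : E × ℝ => A q.1 i j) (x, t) :=
      (hA i j).comp_of_eq analyticAt_fst rfl
    have h2 : AnalyticAt ℝ (fun q : E × ℝ => (q.2 : ℂ)) (x, t) :=
      analyticAt_ofReal analyticAt_snd
    by_cases hij : i = j
    · subst hij
      simpa using h2.fun_sub h1
    · simpa [hij] using h1.fun_neg
  have hex : ∀ l, ∃ r : E → ℝ, AnalyticAt ℝ r x ∧ r x = eig (A x) l ∧
      ∀ᶠ z in 𝓝 x, F (z, r z) = 0 := by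
    intro l
    refine exists_analytic_root (hFan _)
      -- The derivative of `∏ (t - λ_m)` at `λ_l`, nonzero because the roots are distinct.
      (c := ∏ m ∈ Finset.univ.erase l, (eig (A x) l - eig (A x) m)) ?_ ?_ ?_
    · rw [hFprod]
      exact Finset.prod_eq_zero (Finset.mem_univ l) (by simp)
    · simp only [hFprod]
      have h1 : (fun t : ℝ => ∏ m, (t - eig (A x) m)) =
          fun t => (t - eig (A x) l) * ∏ m ∈ Finset.univ.erase l, (t - eig (A x) m) := by
        funext t
        rw [Finset.mul_prod_erase _ (fun m => t - eig (A x) m) (Finset.mem_univ l)]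
      have hdiff : Differentiable ℝ
          (fun t : ℝ => ∏ m ∈ Finset.univ.erase l, (t - eig (A x) m)) := by fun_prop
      rw [h1]
      have := ((hasDerivAt_id (eig (A x) l)).sub_const (eig (A x) l)).fun_mul
        (hdiff (eig (A x) l)).hasDerivAt
      simpa using this
    · rw [Finset.prod_ne_zero_iff]
      intro m hm
      rw [sub_ne_zero]
      exact fun h => (Finset.mem_erase.1 hm).1 (hinj h.symm)
  choose r hr hrx hrF using hex
  have hanti : ∀ᶠ z in 𝓝 x, StrictAnti (fun i => r (e i) z) := by
    have : ∀ i j : Fin n, ∀ᶠ z in 𝓝 x, i < j → r (e j) z < r (e i) z := by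
      intro i j
      by_cases hij : i < j
      · have h1 : r (e j) x < r (e i) x := by
          rw [hrx, hrx]
          exact ((he (A x)).strictAnti_of_injective (hinj.comp e.injective)) hij
        filter_upwards [(hr (e j)).continuousAt.eventually_lt (hr (e i)).continuousAt h1]
          with z hz _ using hz
      · exact Eventually.of_forall fun _ h => absurd h hij
    filter_upwards [eventually_all.2 fun i => eventually_all.2 (this i)] with z hz i j hij
    exact hz i j hij
  have heq : ∀ᶠ z in 𝓝 x, r k z = eig (A z) k := by
    filter_upwards [hanti, eventually_all.2 hrF] with z hz hzF
    refine (congrFun (eig_eq_of_antitone_roots (hH z) (he (A z)) (r := fun l => r l z) hz fun l => ?_) k).symm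
    have h1 := hzF l
    rw [hFprod] at h1
    rw [charpoly_eq_prod_eig (hH _), Polynomial.eval_prod]
    have : ((∏ m, (r l z - eig (A z) m) : ℝ) : ℂ) = 0 := by exact_mod_cast h1
    simpa using this
  exact (hr k).congr heq

end Analytic

/-! ### The principal square root -/

/-- The principal square root of a real number. -/
noncomputable def psqrt (x : ℝ) : ℂ := (√x : ℂ) + Complex.I * (√(-x) : ℂ)

theorem psqrt_sq (x : ℝ) : psqrt x ^ 2 = x := by
  -- `Real.sqrt` vanishes on nonpositive numbers, so one summand of `psqrt` is always zero.
  rcases le_total 0 x with h | h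
  · rw [psqrt, Real.sqrt_eq_zero_of_nonpos (neg_nonpos.2 h)]
    simp only [Complex.ofReal_zero, mul_zero, add_zero]
    exact_mod_cast Real.sq_sqrt h
  · rw [psqrt, Real.sqrt_eq_zero_of_nonpos h]
    have := Real.sq_sqrt (neg_nonneg.2 h)
    simp only [Complex.ofReal_zero, zero_add, mul_pow, Complex.I_sq]
    rw [← Complex.ofReal_pow, this]
    simp

theorem psqrt_re_im_nonneg (x : ℝ) : 0 ≤ (psqrt x).re ∧ 0 ≤ (psqrt x).im := by
  simp [psqrt, Real.sqrt_nonneg]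

/-- Two square roots agree up to sign, and opposite points of the closed first quadrant are both
zero. -/
theorem eq_psqrt {w : ℂ} {x : ℝ} (hre : 0 ≤ w.re) (him : 0 ≤ w.im) (h : w ^ 2 = x) :
    w = psqrt x := by
  have h1 : (w - psqrt x) * (w + psqrt x) = 0 := by
    linear_combination h - psqrt_sq x
  rcases mul_eq_zero.1 h1 with h2 | h2
  · exact sub_eq_zero.1 h2
  · obtain ⟨hr, hi⟩ := psqrt_re_im_nonneg x
    have h3 : w.re + (psqrt x).re = 0 := by simpa using congrArg Complex.re h2
    have h4 : w.im + (psqrt x).im = 0 := by simpa using congrArg Complex.im h2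
    apply Complex.ext <;> linarith

theorem psqrt_ne_zero {x : ℝ} (hx : x ≠ 0) : psqrt x ≠ 0 := by
  intro h
  have := psqrt_sq x
  rw [h] at this
  apply hx
  have h2 : (x : ℂ) = 0 := by rw [← this]; simp
  exact_mod_cast h2

theorem psqrt_injective : Function.Injective psqrt := by
  intro x y h
  have h2 : (x : ℂ) = y := by rw [← psqrt_sq, ← psqrt_sq, h]
  exact_mod_cast h2

theorem analyticAt_sqrt {x : ℝ} (hx : x ≠ 0) : AnalyticAt ℝ (fun y => √y) x :=
  (Real.contDiffAt_sqrt (n := ⊤) hx).analyticAt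

section Analytic

variable {E : Type*} [NormedAddCommGroup E] [NormedSpace ℝ E]

theorem analyticAt_psqrt {f : E → ℝ} {x : E} (hf : AnalyticAt ℝ f x) (h : f x ≠ 0) :
    AnalyticAt ℝ (fun y => psqrt (f y)) x := by
  refine (analyticAt_ofReal ?_).add (analyticAt_const.mul (analyticAt_ofReal ?_))
  · exact (analyticAt_sqrt h).comp hf
  · exact (analyticAt_sqrt (neg_ne_zero.2 h)).comp_of_eq hf.fun_neg rfl

/-! ### Zero sets of analytic functions -/

theorem ae_ne_zero_of_analytic {g : ℝ → ℂ} (hg : ∀ t, AnalyticAt ℝ g t) {s : ℝ} (hs : g s ≠ 0) :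
    ∀ᵐ t, g t ≠ 0 := by
  have hg' : AnalyticOnNhd ℝ g Set.univ := fun t _ => hg t
  rcases hg'.eqOn_zero_or_eventually_ne_zero_of_preconnected isPreconnected_univ with h | h
  · exact absurd (h (Set.mem_univ s)) hs
  · have := ae_restrict_le_codiscreteWithin (μ := volume) MeasurableSet.univ h
    rw [Measure.restrict_univ] at this
    exact this

theorem eventually_ne_zero_of_analytic {g : ℝ → ℂ} (hg : ∀ t, AnalyticAt ℝ g t) {s : ℝ}
    (hs : g s ≠ 0) (t : ℝ) : ∀ᶠ x in 𝓝[≠] t, g x ≠ 0 := by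
  by_contra h
  have hg' : AnalyticOnNhd ℝ g Set.univ := fun t _ => hg t
  have hf : ∃ᶠ x in 𝓝[≠] t, g x = 0 := (Filter.not_eventually.1 h).mono fun x hx => not_not.1 hx
  exact hs (hg'.eqOn_zero_of_preconnected_of_frequently_eq_zero isPreconnected_univ
    (Set.mem_univ t) hf (Set.mem_univ s))

/-- The zero set of a nonzero real-analytic function on `ℝ^d` is a null set. -/
theorem volume_zeros_eq_zero {d : ℕ} {f : (Fin d → ℝ) → ℂ} (hf : ∀ x, AnalyticAt ℝ f x)
    {p : Fin d → ℝ} (hp : f p ≠ 0) : volume {x | f x = 0} = 0 := by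
  induction d with
  | zero =>
    have : {x | f x = 0} = ∅ := by
      ext x
      simpa [Subsingleton.elim x p] using hp
    rw [this, measure_empty]
  | succ d ih =>
    let e := MeasurableEquiv.piFinSuccAbove (fun _ : Fin (d + 1) => ℝ) 0
    have he : MeasurePreserving e.symm :=
      (volume_preserving_piFinSuccAbove (fun _ : Fin (d + 1) => ℝ) 0).symm e
    have hsymm : ∀ a b, e.symm (a, b) = Fin.cons a b := by
      intro a b
      simp [e, MeasurableEquiv.piFinSuccAbove, Fin.insertNthEquiv]
    have hcont : Continuous f := continuous_iff_continuousAt.2 fun x => (hf x).continuousAt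
    have hmeas : MeasurableSet {x | f x = 0} := (isClosed_singleton.preimage hcont).measurableSet
    rw [← he.measure_preimage hmeas.nullMeasurableSet]
    rw [show (volume : Measure (ℝ × (Fin d → ℝ))) = volume.prod volume from rfl,
      Measure.measure_prod_null (e.symm.measurable hmeas)]
    have hcons : ∀ a b, AnalyticAt ℝ (fun q : ℝ × (Fin d → ℝ) => f (Fin.cons q.1 q.2)) (a, b) := by
      intro a b
      refine (hf (Fin.cons a b)).comp_of_eq ?_ rfl
      rw [analyticAt_pi_iff]
      intro i
      refine Fin.cases ?_ (fun j => ?_) i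
      · simpa using analyticAt_fst
      · have := ((ContinuousLinearMap.proj (R := ℝ) (φ := fun _ : Fin d => ℝ) j).comp
          (ContinuousLinearMap.snd ℝ ℝ (Fin d → ℝ))).analyticAt (a, b)
        simpa using! this
    -- Fubini: for almost every first coordinate the slice is nonzero at the tail of `p`, so its
    -- zero set is null by induction.
    have h1 : ∀ᵐ a : ℝ, f (Fin.cons a (Fin.tail p)) ≠ 0 := by
      refine ae_ne_zero_of_analytic (fun t => ?_) (s := p 0) (by rwa [Fin.cons_self_tail])
      exact (hcons t (Fin.tail p)).comp_of_eq (analyticAt_id.prod analyticAt_const) rfl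
    filter_upwards [h1] with a ha
    have h2 := ih (f := fun b => f (Fin.cons a b)) (fun b =>
      (hcons a b).comp_of_eq (analyticAt_const.prod analyticAt_id) rfl) ha
    simp only [Pi.zero_apply]
    convert h2 using 2
    ext b
    simp [hsymm]

/-! ### Derivatives with parameters and under perturbation of the square -/

section PartialDeriv

variable {d : ℕ}

/-- A partial derivative in `θ` is the full derivative in the direction `(0, e_i)`, so analyticity
in the parameter survives. -/
theorem analyticAt_partialDeriv_param {f : E × (Fin d → ℝ) → ℂ} {q : E × (Fin d → ℝ)}
    (hf : AnalyticAt ℝ f q) (i : Fin d) :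
    AnalyticAt ℝ (fun p => partialDeriv i (fun θ => f (p.1, θ)) p.2) q := by
  have h1 : AnalyticAt ℝ (fun p => fderiv ℝ f p (0, Pi.single i 1)) q :=
    ((ContinuousLinearMap.apply ℝ ℂ ((0 : E), (Pi.single i 1 : Fin d → ℝ))).analyticAt _).comp
      hf.fderiv
  refine h1.congr ?_
  filter_upwards [hf.eventually_analyticAt] with p hp
  have h2 : HasFDerivAt (fun θ => f (p.1, θ))
      ((fderiv ℝ f p).comp (ContinuousLinearMap.inr ℝ E (Fin d → ℝ))) p.2 :=
    HasFDerivAt.comp p.2 (g := f) hp.differentiableAt.hasFDerivAt (hasFDerivAt_prodMk_right p.1 p.2)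
  simp [partialDeriv, h2.fderiv]

theorem analyticAt_hessDet_param {f : E × (Fin d → ℝ) → ℂ} {q : E × (Fin d → ℝ)}
    (hf : AnalyticAt ℝ f q) :
    AnalyticAt ℝ (fun p => hessDet (fun θ => f (p.1, θ)) p.2) q :=
  analyticAt_det fun i j =>
    analyticAt_partialDeriv_param (analyticAt_partialDeriv_param hf j) i

theorem partialDeriv_congr {f g : (Fin d → ℝ) → ℂ} {θ : Fin d → ℝ} (h : f =ᶠ[𝓝 θ] g)
    (i : Fin d) : partialDeriv i f =ᶠ[𝓝 θ] partialDeriv i g := by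
  filter_upwards [h.fderiv (𝕜 := ℝ)] with x hx
  simp [partialDeriv, hx]

theorem hessDet_congr {f g : (Fin d → ℝ) → ℂ} {θ : Fin d → ℝ} (h : f =ᶠ[𝓝 θ] g) :
    hessDet f θ = hessDet g θ := by
  have : ∀ i j, partialDeriv i (partialDeriv j f) θ = partialDeriv i (partialDeriv j g) θ :=
    fun i j => (partialDeriv_congr (partialDeriv_congr h j) i).eq_of_nhds
  simp only [hessDet, this]

theorem analyticAt_partialDeriv {f : (Fin d → ℝ) → ℂ} {θ : Fin d → ℝ}
    (hf : AnalyticAt ℝ f θ) (i : Fin d) : AnalyticAt ℝ (partialDeriv i f) θ :=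
  ((ContinuousLinearMap.apply ℝ ℂ (Pi.single i 1 : Fin d → ℝ)).analyticAt _).comp hf.fderiv

theorem partialDeriv_add {f g : (Fin d → ℝ) → ℂ} {θ : Fin d → ℝ}
    (hf : AnalyticAt ℝ f θ) (hg : AnalyticAt ℝ g θ) (i : Fin d) :
    partialDeriv i (fun x => f x + g x) θ = partialDeriv i f θ + partialDeriv i g θ := by
  simp [partialDeriv, fderiv_fun_add hf.differentiableAt hg.differentiableAt]

theorem partialDeriv_mul {f g : (Fin d → ℝ) → ℂ} {θ : Fin d → ℝ}
    (hf : AnalyticAt ℝ f θ) (hg : AnalyticAt ℝ g θ) (i : Fin d) :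
    partialDeriv i (fun x => f x * g x) θ =
      f θ * partialDeriv i g θ + g θ * partialDeriv i f θ := by
  simp [partialDeriv, fderiv_fun_mul hf.differentiableAt hg.differentiableAt]

/-- Differentiating the relation between squares avoids differentiating a square root. The
conclusion holds on a neighbourhood so that it can be differentiated again. -/
theorem partialDeriv_perturb {g w φ : (Fin d → ℝ) → ℂ} {θ : Fin d → ℝ}
    (hg : AnalyticAt ℝ g θ) (hw : AnalyticAt ℝ w θ) (hφ : AnalyticAt ℝ φ θ)
    (h : ∀ᶠ x in 𝓝 θ, g x * g x = w x * w x + φ x) (i : Fin d) :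
    ∀ᶠ x in 𝓝 θ, 2 * (g x * partialDeriv i g x) = 2 * (w x * partialDeriv i w x) +
      partialDeriv i φ x := by
  filter_upwards [partialDeriv_congr h i, hg.eventually_analyticAt, hw.eventually_analyticAt,
    hφ.eventually_analyticAt] with x hx hgx hwx hφx
  rw [partialDeriv_mul hgx hgx, partialDeriv_add (f := fun x => w x * w x) (hwx.fun_mul hwx) hφx,
    partialDeriv_mul hwx hwx] at hx
  linear_combination hx

theorem partialDeriv_perturb_apply {g w φ : (Fin d → ℝ) → ℂ} {θ : Fin d → ℝ}
    (hg : AnalyticAt ℝ g θ) (hw : AnalyticAt ℝ w θ) (hφ : AnalyticAt ℝ φ θ)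
    (h : ∀ᶠ x in 𝓝 θ, g x * g x = w x * w x + φ x) (hgw : g θ = w θ) (h0 : w θ ≠ 0)
    (i : Fin d) :
    partialDeriv i g θ = partialDeriv i w θ + partialDeriv i φ θ / (2 * w θ) := by
  have := (partialDeriv_perturb hg hw hφ h i).self_of_nhds
  rw [hgw] at this
  field_simp
  linear_combination this

/-- As `φ` has zero gradient at `θ`, the gradients of `g` and `w` agree there. The products of first
derivatives cancel in the twice differentiated relation, leaving only second derivatives. -/
theorem partialDeriv_partialDeriv_perturb {g w φ : (Fin d → ℝ) → ℂ} {θ : Fin d → ℝ}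
    (hg : AnalyticAt ℝ g θ) (hw : AnalyticAt ℝ w θ) (hφ : AnalyticAt ℝ φ θ)
    (h : ∀ᶠ x in 𝓝 θ, g x * g x = w x * w x + φ x) (hgw : g θ = w θ) (h0 : w θ ≠ 0)
    (hφ1 : ∀ i, partialDeriv i φ θ = 0) (i j : Fin d) :
    partialDeriv i (partialDeriv j g) θ = partialDeriv i (partialDeriv j w) θ +
      partialDeriv i (partialDeriv j φ) θ / (2 * w θ) := by
  have h1 : ∀ k, partialDeriv k g θ = partialDeriv k w θ := fun k => by
    simpa [hφ1] using partialDeriv_perturb_apply hg hw hφ h hgw h0 k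
  have hgj := analyticAt_partialDeriv hg j
  have hwj := analyticAt_partialDeriv hw j
  have hφj := analyticAt_partialDeriv hφ j
  have h2 := (partialDeriv_congr (partialDeriv_perturb hg hw hφ h j) i).eq_of_nhds
  have hc : AnalyticAt ℝ (fun _ : Fin d → ℝ => (2 : ℂ)) θ := analyticAt_const
  have hc0 : partialDeriv i (fun _ : Fin d → ℝ => (2 : ℂ)) θ = 0 := by simp [partialDeriv]
  rw [partialDeriv_mul (g := fun x => g x * partialDeriv j g x) hc (hg.fun_mul hgj),
    partialDeriv_mul hg hgj,
    partialDeriv_add (f := fun x => 2 * (w x * partialDeriv j w x))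
      (hc.fun_mul (hw.fun_mul hwj)) hφj,
    partialDeriv_mul (g := fun x => w x * partialDeriv j w x) hc (hw.fun_mul hwj),
    partialDeriv_mul hw hwj, hc0, hgw, h1, h1] at h2
  field_simp
  linear_combination h2

end PartialDeriv

end Analytic

/-! ### Nonvanishing for small nonzero parameters -/

theorem eventually_affine_ne_zero (a : ℂ) {b : ℂ} (hb : b ≠ 0) :
    ∀ᶠ ε : ℝ in 𝓝[≠] 0, a + b * ε ≠ 0 := by
  by_cases ha : a = 0
  · filter_upwards [self_mem_nhdsWithin] with ε hε
    simpa [ha, hb] using hε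
  · have hc : ContinuousAt (fun ε : ℝ => a + b * ε) 0 := by fun_prop
    exact (hc.eventually_ne (by simpa using ha)).filter_mono nhdsWithin_le_nhds

/-- Up to the factor `z ^ d`, the determinant is the characteristic polynomial of `-z⁻¹ H` at `ε`.
It is monic, so it has finitely many roots. -/
theorem eventually_det_add_smul_ne_zero {d : ℕ} (H : Matrix (Fin d) (Fin d) ℂ) {z : ℂ}
    (hz : z ≠ 0) : ∀ᶠ ε : ℝ in 𝓝[≠] 0, (H + ((ε : ℂ) * z) • (1 : Matrix (Fin d) (Fin d) ℂ)).det ≠ 0 := by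
  let p := (-(z⁻¹ • H)).charpoly
  have hp : p ≠ 0 := (Matrix.charpoly_monic _).ne_zero
  have hfin : ((fun ε : ℝ => (ε : ℂ)) ⁻¹' {x | p.IsRoot x}).Finite :=
    (Polynomial.finite_setOfPred_isRoot hp).preimage Complex.ofReal_injective.injOn
  have hne : ∀ᶠ ε : ℝ in 𝓝[≠] 0, ε ∉ (fun ε : ℝ => (ε : ℂ)) ⁻¹' {x | p.IsRoot x} \ {0} :=
    Filter.Eventually.filter_mono nhdsWithin_le_nhds
      ((hfin.subset Set.sdiff_subset).isClosed.isOpen_compl.mem_nhds (by simp))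
  filter_upwards [hne, self_mem_nhdsWithin] with ε hε h0 hdet
  refine hε ⟨?_, h0⟩
  have h1 : H + ((ε : ℂ) * z) • (1 : Matrix (Fin d) (Fin d) ℂ) =
      z • (Matrix.scalar (Fin d) (ε : ℂ) - (-(z⁻¹ • H))) := by
    rw [Matrix.scalar_apply, ← Matrix.smul_one_eq_diagonal, sub_neg_eq_add, smul_add, smul_smul,
      smul_smul, mul_inv_cancel₀ hz, one_smul, add_comm, mul_comm]
  rw [h1, Matrix.det_smul] at hdet
  simp only [Set.mem_preimage, Set.mem_ofPred_eq, Polynomial.IsRoot, p, Matrix.eval_charpoly]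
  exact (mul_eq_zero.1 hdet).resolve_left (pow_ne_zero _ hz)

/-! ### Trigonometric symbols and their coefficients -/

/-- The lattice points `z` with `max_i |z_i| ≤ N`. -/
noncomputable def box (d N : ℕ) : Finset (Fin d → ℤ) :=
  Fintype.piFinset fun _ => Finset.Icc (-(N : ℤ)) N

theorem notMem_box {d N : ℕ} {z : Fin d → ℤ} (hz : z ∉ box d N) : ∃ i, (N : ℤ) < |z i| := by
  by_contra! h
  exact hz (Fintype.mem_piFinset.2 fun i => Finset.mem_Icc.2 (abs_le.1 (h i)))

/-- The plane wave `e^{iz·θ}`. -/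
noncomputable def wave {d : ℕ} (z : Fin d → ℤ) (θ : Fin d → ℝ) : ℂ :=
  Complex.exp (Complex.I * ∑ i, (z i : ℂ) * (θ i : ℂ))

theorem conj_wave {d : ℕ} (z : Fin d → ℤ) (θ : Fin d → ℝ) :
    starRingEnd ℂ (wave z θ) = wave (-z) θ := by
  simp [wave, ← Complex.exp_conj]

theorem wave_periodShift {d : ℕ} (z : Fin d → ℤ) (m : Fin d → ℤ) (θ : Fin d → ℝ) :
    wave z (periodShift m θ) = wave z θ := by
  have : Complex.I * ∑ i, (z i : ℂ) * ((periodShift m θ i : ℝ) : ℂ) =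
      Complex.I * ∑ i, (z i : ℂ) * (θ i : ℂ) +
        ((∑ i, z i * m i : ℤ) : ℂ) * (2 * Real.pi * Complex.I) := by
    simp only [periodShift, Complex.ofReal_add, Complex.ofReal_mul, Complex.ofReal_ofNat,
      Complex.ofReal_intCast, mul_add, Finset.sum_add_distrib, Int.cast_sum, Int.cast_mul,
      Finset.sum_mul, Finset.mul_sum]
    congr 1
    exact Finset.sum_congr rfl fun i _ => by ring
  rw [wave, this, Complex.exp_periodic.int_mul _ _, wave]

theorem vHat_periodShift {d n : ℕ} (V : Interaction d n) (m : Fin d → ℤ) (θ : Fin d → ℝ) :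
    vHat V (periodShift m θ) = vHat V θ := by
  ext k l
  simp only [vHat, Matrix.of_apply]
  exact tsum_congr fun z => congrArg _ (wave_periodShift z m θ)

theorem vHat_apply {d n N : ℕ} {V : Interaction d n} (hV : V ∈ FiniteRange d n N)
    (θ : Fin d → ℝ) (k l : Fin n) :
    vHat V θ k l = ∑ z ∈ box d N, (V z k l : ℂ) * wave z θ := by
  simp only [vHat, Matrix.of_apply]
  refine tsum_eq_sum fun z hz => ?_
  simp [hV.2 z (notMem_box hz)]

theorem isHermitian_vHat {d n N : ℕ} {V : Interaction d n} (hV : V ∈ FiniteRange d n N)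
    (θ : Fin d → ℝ) : (vHat V θ).IsHermitian := by
  ext k l
  rw [Matrix.conjTranspose_apply, vHat_apply hV, vHat_apply hV, Complex.star_def, map_sum]
  refine Finset.sum_bij (fun z _ => -z) (fun z hz => ?_) (fun _ _ _ _ h => neg_injective h)
    (fun z hz => ⟨-z, ?_, neg_neg z⟩) (fun z hz => ?_)
  · simp only [box, Fintype.mem_piFinset, Finset.mem_Icc, Pi.neg_apply] at hz ⊢
    exact fun i => ⟨by linarith [(hz i).2], by linarith [(hz i).1]⟩
  · simp only [box, Fintype.mem_piFinset, Finset.mem_Icc, Pi.neg_apply] at hz ⊢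
    exact fun i => ⟨by linarith [(hz i).2], by linarith [(hz i).1]⟩
  · rw [map_mul, conj_wave, Complex.conj_ofReal, ← hV.1 (-z), neg_neg]

/-- The space of interaction matrices of range `N` is a linear subspace. -/
def finiteRangeSubmodule (d n N : ℕ) : Submodule ℝ (Interaction d n) where
  carrier := FiniteRange d n N
  add_mem' {V W} hV hW := ⟨fun z k l => by simp [hV.1 z k l, hW.1 z k l],
    fun x hx => by simp [hV.2 x hx, hW.2 x hx]⟩
  zero_mem' := ⟨fun z k l => by simp, fun x _ => rfl⟩
  smul_mem' c V hV := ⟨fun z k l => by simp [hV.1 z k l], fun x hx => by simp [hV.2 x hx]⟩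

theorem add_smul_mem_finiteRange {d n N : ℕ} {V W : Interaction d n}
    (hV : V ∈ FiniteRange d n N) (hW : W ∈ FiniteRange d n N) (ε : ℝ) :
    V + ε • W ∈ FiniteRange d n N :=
  (finiteRangeSubmodule d n N).add_mem hV ((finiteRangeSubmodule d n N).smul_mem ε hW)

theorem vHat_add_smul {d n N : ℕ} {V W : Interaction d n}
    (hV : V ∈ FiniteRange d n N) (hW : W ∈ FiniteRange d n N) (ε : ℝ) (θ : Fin d → ℝ) :
    vHat (V + ε • W) θ = vHat V θ + (ε : ℂ) • vHat W θ := by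
  ext k l
  rw [vHat_apply (add_smul_mem_finiteRange hV hW ε), Matrix.add_apply, Matrix.smul_apply,
    vHat_apply hV, vHat_apply hW, smul_eq_mul, Finset.mul_sum, ← Finset.sum_add_distrib]
  refine Finset.sum_congr rfl fun z _ => ?_
  simp
  ring

/-- Coefficient vectors: interaction matrices restricted to the box. -/
abbrev Coef (d n N : ℕ) : Type := box d N → Fin n → Fin n → ℝ

/-- The coefficients of an interaction matrix. -/
def coef {d n N : ℕ} (V : Interaction d n) : Coef d n N := fun z k l => V z k l

/-- The trigonometric matrix polynomial with the given coefficients. -/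
noncomputable def trigPoly {d n N : ℕ} (q : Coef d n N × (Fin d → ℝ)) (k l : Fin n) : ℂ :=
  ∑ z, (q.1 z k l : ℂ) * wave z.1 q.2

/-- The Hermitian part of the trigonometric matrix polynomial with the given coefficients. -/
noncomputable def symHat {d n N : ℕ} (q : Coef d n N × (Fin d → ℝ)) :
    Matrix (Fin n) (Fin n) ℂ :=
  Matrix.of fun k l => (1 / 2 : ℂ) * (trigPoly q k l + starRingEnd ℂ (trigPoly q l k))

theorem isHermitian_symHat {d n N : ℕ} (q : Coef d n N × (Fin d → ℝ)) :
    (symHat q).IsHermitian := by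
  ext k l
  simp [symHat, add_comm]

/-- Symmetrizing changes nothing on genuine interactions. On arbitrary coefficients it keeps the
matrix Hermitian, so the branches can be studied on a full finite-dimensional normed space. -/
theorem symHat_coef {d n N : ℕ} {V : Interaction d n} (hV : V ∈ FiniteRange d n N)
    (θ : Fin d → ℝ) : symHat ((coef V : Coef d n N), θ) = vHat V θ := by
  have h : ∀ k l, trigPoly ((coef V : Coef d n N), θ) k l = vHat V θ k l := by
    intro k l
    rw [vHat_apply hV, ← Finset.sum_coe_sort]
    rfl
  ext k l
  have h2 := congrFun (congrFun (isHermitian_vHat hV θ) k) l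
  rw [Matrix.conjTranspose_apply, Complex.star_def] at h2
  simp only [symHat, Matrix.of_apply, h, h2]
  ring

theorem analyticAt_wave {d : ℕ} (z : Fin d → ℤ) (θ : Fin d → ℝ) : AnalyticAt ℝ (wave z) θ := by
  have h : AnalyticAt ℝ (fun θ : Fin d → ℝ => Complex.I * ∑ i, (z i : ℂ) * (θ i : ℂ)) θ := by
    refine analyticAt_const.mul (Finset.analyticAt_fun_sum _ fun i _ =>
      analyticAt_const.mul (analyticAt_ofReal ?_))
    exact (ContinuousLinearMap.proj (R := ℝ) (φ := fun _ : Fin d => ℝ) i).analyticAt θ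
  exact (analyticAt_cexp.restrictScalars (𝕜 := ℝ)).comp h

theorem analyticAt_trigPoly {d n N : ℕ} (q : Coef d n N × (Fin d → ℝ)) (k l : Fin n) :
    AnalyticAt ℝ (fun p : Coef d n N × (Fin d → ℝ) => trigPoly p k l) q := by
  refine Finset.analyticAt_fun_sum _ fun z _ => (analyticAt_ofReal ?_).mul
    ((analyticAt_wave _ _).comp_of_eq analyticAt_snd rfl)
  have h1 : AnalyticAt ℝ (fun p : Coef d n N × (Fin d → ℝ) => p.1) q := analyticAt_fst
  have h2 : AnalyticAt ℝ (fun p : Coef d n N × (Fin d → ℝ) => p.1 z) q :=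
    analyticAt_pi_iff.1 h1 z
  have h3 : AnalyticAt ℝ (fun p : Coef d n N × (Fin d → ℝ) => p.1 z k) q :=
    analyticAt_pi_iff.1 h2 k
  exact analyticAt_pi_iff.1 h3 l

theorem analyticAt_symHat {d n N : ℕ} (q : Coef d n N × (Fin d → ℝ)) (k l : Fin n) :
    AnalyticAt ℝ (fun p : Coef d n N × (Fin d → ℝ) => symHat p k l) q := by
  simp only [symHat, Matrix.of_apply]
  refine analyticAt_const.mul ((analyticAt_trigPoly q k l).add ?_)
  exact (Complex.conjCLE.toContinuousLinearMap.analyticAt _).comp (analyticAt_trigPoly q l k)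

theorem analyticAt_vHat {d n N : ℕ} {V : Interaction d n} (hV : V ∈ FiniteRange d n N)
    (θ : Fin d → ℝ) (k l : Fin n) : AnalyticAt ℝ (fun x => vHat V x k l) θ := by
  simp only [vHat_apply hV]
  exact Finset.analyticAt_fun_sum _ fun z _ => analyticAt_const.mul (analyticAt_wave z θ)

/-! ### Regular momenta and openness -/

/-- The function which is nonzero exactly when the eigenvalues are simple and nonzero. -/
noncomputable def simpleDisc {n : ℕ} (A : Matrix (Fin n) (Fin n) ℂ) : ℂ := traceDisc A * A.det

theorem simpleDisc_ne_zero_iff {n : ℕ} {A : Matrix (Fin n) (Fin n) ℂ} (hA : A.IsHermitian) :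
    simpleDisc A ≠ 0 ↔ Function.Injective (eig A) ∧ ∀ k, eig A k ≠ 0 := by
  rw [simpleDisc, mul_ne_zero_iff, traceDisc_ne_zero_iff hA, det_ne_zero_iff_eig hA]

theorem analyticAt_simpleDisc {E : Type*} [NormedAddCommGroup E] [NormedSpace ℝ E] {n : ℕ}
    {A : E → Matrix (Fin n) (Fin n) ℂ} {x : E}
    (hA : ∀ i j, AnalyticAt ℝ (fun y => A y i j) x) :
    AnalyticAt ℝ (fun y => simpleDisc (A y)) x :=
  (analyticAt_traceDisc hA).mul (analyticAt_det hA)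

/-- The ordered dispersion relations of a family of Hermitian matrices. -/
noncomputable def branch {X : Type*} {n : ℕ} (A : X → Matrix (Fin n) (Fin n) ℂ) (k : Fin n)
    (x : X) : ℂ := psqrt (eig (A x) k)

theorem analyticAt_branch {E : Type*} [NormedAddCommGroup E] [NormedSpace ℝ E] [CompleteSpace E]
    {n : ℕ} {A : E → Matrix (Fin n) (Fin n) ℂ} {x : E} (hH : ∀ y, (A y).IsHermitian)
    (hA : ∀ i j, AnalyticAt ℝ (fun y => A y i j) x) (hd : simpleDisc (A x) ≠ 0) (k : Fin n) :
    AnalyticAt ℝ (branch A k) x := by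
  rw [simpleDisc_ne_zero_iff (hH x)] at hd
  exact analyticAt_psqrt (analyticAt_eig hH hA hd.1 k) (hd.2 k)

theorem branch_coef {d n N : ℕ} {V : Interaction d n} (hV : V ∈ FiniteRange d n N) (k : Fin n) :
    (fun θ => branch symHat k ((coef V : Coef d n N), θ)) = branch (vHat V) k := by
  funext θ
  simp [branch, symHat_coef hV]

theorem continuous_coef {d n N : ℕ} :
    Continuous fun V : FiniteRange d n N => (coef V.1 : Coef d n N) :=
  continuous_pi fun z => continuous_pi fun k => continuous_pi fun l =>
    (continuous_apply l).comp ((continuous_apply k).comp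
      ((continuous_apply z.1).comp continuous_subtype_val))

/-- Existence of a good momentum is an open condition. -/
theorem isOpen_exists_momentum {d n N : ℕ} {P : Coef d n N × (Fin d → ℝ) → Prop}
    (hP : ∀ q, P q → ∀ᶠ p in 𝓝 q, P p) :
    IsOpen {V : FiniteRange d n N | ∃ θ, P (coef V.1, θ)} := by
  have h1 : IsOpen {q | P q} := isOpen_iff_eventually.2 hP
  -- Existence of a momentum is projection of an open set of pairs, and projections are open maps.
  have h2 : {V : FiniteRange d n N | ∃ θ, P (coef V.1, θ)} =
      (fun V : FiniteRange d n N => (coef V.1 : Coef d n N)) ⁻¹' (Prod.fst '' {q | P q}) := by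
    ext V
    constructor
    · rintro ⟨θ, h⟩
      exact ⟨_, h, rfl⟩
    · rintro ⟨⟨v, θ⟩, h, rfl⟩
      exact ⟨θ, h⟩
  rw [h2]
  exact (isOpenMap_fst _ h1).preimage continuous_coef

/-- A null set misses some point of every open condition which holds somewhere. -/
theorem exists_notMem_of_eventually {d : ℕ} {C : Set (Fin d → ℝ)} (hC : volume C = 0)
    {P : (Fin d → ℝ) → Prop} {θ : Fin d → ℝ} (hP : ∀ᶠ x in 𝓝 θ, P x) : ∃ x, x ∉ C ∧ P x := by
  have h : Dense Cᶜ := by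
    have : ∀ᵐ x, x ∈ Cᶜ := measure_eq_zero_iff_ae_notMem.1 hC
    exact Measure.dense_of_ae this
  obtain ⟨x, hx, hx2⟩ := (h.inter_nhds_nonempty hP)
  exact ⟨x, hx, hx2⟩

theorem hessCond_isOpen {d n N : ℕ} (q : Coef d n N × (Fin d → ℝ))
    (hq : simpleDisc (symHat q) ≠ 0 ∧
      ∀ k, hessDet (fun θ => branch symHat k (q.1, θ)) q.2 ≠ 0) :
    ∀ᶠ p : Coef d n N × (Fin d → ℝ) in 𝓝 q, simpleDisc (symHat p) ≠ 0 ∧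
      ∀ k, hessDet (fun θ => branch symHat k (p.1, θ)) p.2 ≠ 0 := by
  refine ((analyticAt_simpleDisc (analyticAt_symHat q)).continuousAt.eventually_ne hq.1).and
    (eventually_all.2 fun k => ?_)
  exact (analyticAt_hessDet_param (analyticAt_branch isHermitian_symHat (analyticAt_symHat q)
    hq.1 k)).continuousAt.eventually_ne (hq.2 k)

theorem gradCond_isOpen {d n N : ℕ} (i : Fin d) (q : Coef d n N × (Fin d → ℝ))
    (hq : simpleDisc (symHat q) ≠ 0 ∧ ∀ k l, k ≠ l →
      partialDeriv i (fun θ => branch symHat k (q.1, θ)) q.2 -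
        partialDeriv i (fun θ => branch symHat l (q.1, θ)) q.2 ≠ 0 ∧
      partialDeriv i (fun θ => branch symHat k (q.1, θ)) q.2 +
        partialDeriv i (fun θ => branch symHat l (q.1, θ)) q.2 ≠ 0) :
    ∀ᶠ p : Coef d n N × (Fin d → ℝ) in 𝓝 q, simpleDisc (symHat p) ≠ 0 ∧ ∀ k l, k ≠ l →
      partialDeriv i (fun θ => branch symHat k (p.1, θ)) p.2 -
        partialDeriv i (fun θ => branch symHat l (p.1, θ)) p.2 ≠ 0 ∧
      partialDeriv i (fun θ => branch symHat k (p.1, θ)) p.2 +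
        partialDeriv i (fun θ => branch symHat l (p.1, θ)) p.2 ≠ 0 := by
  have han : ∀ k, ContinuousAt (fun p : Coef d n N × (Fin d → ℝ) =>
      partialDeriv i (fun θ => branch symHat k (p.1, θ)) p.2) q := fun k =>
    (analyticAt_partialDeriv_param (analyticAt_branch isHermitian_symHat (analyticAt_symHat q)
      hq.1 k) i).continuousAt
  refine ((analyticAt_simpleDisc (analyticAt_symHat q)).continuousAt.eventually_ne hq.1).and
    (eventually_all.2 fun k => eventually_all.2 fun l => eventually_imp_distrib_left.2 fun hkl => ?_)
  exact (((han k).sub (han l)).eventually_ne (hq.2 k l hkl).1).and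
    (((han k).add (han l)).eventually_ne (hq.2 k l hkl).2)

/-! ### Arbitrary dispersion relations versus ordered branches -/

section Dispersion

variable {d n N : ℕ} {V : Interaction d n} {C : Set (Fin d → ℝ)} {w : Fin n → (Fin d → ℝ) → ℂ}

theorem charpoly_of_isDispersion (h : IsDispersion V C w) {θ : Fin d → ℝ} (hθ : θ ∉ C) :
    (vHat V θ).charpoly = ∏ k, (Polynomial.X - Polynomial.C (w k θ ^ 2)) := by
  obtain ⟨B, hB, hV⟩ := h.diag θ hθ
  have hB2 : B.conjTranspose * B = 1 := Matrix.mem_unitaryGroup_iff'.1 hB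
  rw [hV, unitary_conj_pow hB, Matrix.diagonal_pow, Matrix.charpoly_mul_comm, ← Matrix.mul_assoc,
    hB2, Matrix.one_mul, Matrix.charpoly_diagonal]
  simp

theorem exists_branch_eq (hV : V ∈ FiniteRange d n N) (h : IsDispersion V C w)
    {θ : Fin d → ℝ} (hθ : θ ∉ C) (k : Fin n) : ∃ l, w k θ = branch (vHat V) l θ := by
  have h1 : (vHat V θ).charpoly.eval (w k θ ^ 2) = 0 := by
    rw [charpoly_of_isDispersion h hθ, Polynomial.eval_prod]
    exact Finset.prod_eq_zero (Finset.mem_univ k) (by simp)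
  rw [charpoly_eq_prod_eig (isHermitian_vHat hV θ), Polynomial.eval_prod,
    Finset.prod_eq_zero_iff] at h1
  obtain ⟨l, -, hl⟩ := h1
  refine ⟨l, eq_psqrt (h.principal k θ hθ).1 (h.principal k θ hθ).2 ?_⟩
  simpa [sub_eq_zero] using hl

/-- `exists_branch_eq` alone would allow two relations to share a branch. Comparing root multisets
of the characteristic polynomial excludes this: the `ω_k²` are the eigenvalues with multiplicity,
all simple. -/
theorem injective_of_isDispersion (hV : V ∈ FiniteRange d n N) (h : IsDispersion V C w)
    {θ : Fin d → ℝ} (hθ : θ ∉ C) (hd : simpleDisc (vHat V θ) ≠ 0) :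
    Function.Injective fun k => w k θ := by
  have hH := isHermitian_vHat hV θ
  have hinj := ((simpleDisc_ne_zero_iff hH).1 hd).1
  have h1 := congrArg Polynomial.roots
    ((charpoly_eq_prod_eig hH).symm.trans (charpoly_of_isDispersion h hθ))
  rw [Polynomial.roots_prod _ _ (Finset.prod_ne_zero_iff.2 fun k _ => Polynomial.X_sub_C_ne_zero _),
    Polynomial.roots_prod _ _ (Finset.prod_ne_zero_iff.2 fun k _ => Polynomial.X_sub_C_ne_zero _)]
    at h1
  simp only [Polynomial.roots_X_sub_C, Multiset.bind_singleton] at h1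
  have h2 : (Multiset.map (fun k => (eig (vHat V θ) k : ℂ)) Finset.univ.val).Nodup :=
    Finset.univ.nodup.map (Complex.ofReal_injective.comp hinj)
  rw [h1] at h2
  intro k l hkl
  exact Multiset.inj_on_of_nodup_map h2 k (Finset.mem_univ_val k) l (Finset.mem_univ_val l)
    (by simpa using congrArg (· ^ 2) hkl)

/-- Near a regular momentum every choice of dispersion relations is a permutation of the ordered
branches. -/
theorem exists_local_permutation (hV : V ∈ FiniteRange d n N) (h : IsDispersion V C w)
    {θ : Fin d → ℝ} (hθ : θ ∉ C) (hd : simpleDisc (vHat V θ) ≠ 0) :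
    ∃ σ : Fin n → Fin n, Function.Injective σ ∧
      ∀ k, w k =ᶠ[𝓝 θ] branch (vHat V) (σ k) := by
  choose σ hσ using exists_branch_eq hV h hθ
  have hinj := ((simpleDisc_ne_zero_iff (isHermitian_vHat hV θ)).1 hd).1
  refine ⟨σ, fun k l hkl => injective_of_isDispersion hV h hθ hd ?_, fun k => ?_⟩
  · simp only [hσ, hkl]
  -- By continuity the relation stays away from every branch other than its value at `θ`, and it
  -- must equal some branch.
  · have hne : ∀ l, ∀ᶠ x in 𝓝 θ, l ≠ σ k → w k x ≠ branch (vHat V) l x := by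
      intro l
      by_cases hl : l = σ k
      · exact Eventually.of_forall fun _ h => absurd hl h
      · have hc := ((h.analytic k θ hθ).continuousAt).sub (analyticAt_branch
          (isHermitian_vHat hV) (analyticAt_vHat hV θ) hd l).continuousAt
        have h0 : w k θ - branch (vHat V) l θ ≠ 0 := by
          rw [hσ, sub_ne_zero]
          exact fun h => hl (hinj (psqrt_injective h)).symm
        filter_upwards [hc.eventually_ne h0] with x hx _ using sub_ne_zero.1 hx
    filter_upwards [h.isClosed.isOpen_compl.mem_nhds hθ, eventually_all.2 hne] with x hx hx2
    obtain ⟨l, hl⟩ := exists_branch_eq hV h hx k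
    by_cases hlk : l = σ k
    · rw [hl, hlk]
    · exact absurd hl (hx2 l hlk)

/-- The zero set of `simpleDisc` serves as exceptional set: it is null because this analytic
function is nonzero at `θ₀`. Off it all branches are analytic and pairwise distinct. -/
theorem exists_isDispersion (hV : V ∈ FiniteRange d n N) {θ₀ : Fin d → ℝ}
    (hd : simpleDisc (vHat V θ₀) ≠ 0) :
    ∃ (C : Set (Fin d → ℝ)) (ω : Fin n → (Fin d → ℝ) → ℂ), IsDispersion V C ω := by
  have han : ∀ θ, AnalyticAt ℝ (fun x => simpleDisc (vHat V x)) θ := fun θ =>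
    analyticAt_simpleDisc (analyticAt_vHat hV θ)
  have hcont : Continuous fun x => simpleDisc (vHat V x) :=
    continuous_iff_continuousAt.2 fun x => (han x).continuousAt
  refine ⟨{θ | simpleDisc (vHat V θ) = 0}, branch (vHat V), ?_⟩
  constructor
  · exact isClosed_singleton.preimage hcont
  · intro θ hθ m
    simpa [vHat_periodShift] using hθ
  · exact volume_zeros_eq_zero han hd
  · intro k θ _ m
    simp [branch, vHat_periodShift]
  · intro θ _
    obtain ⟨U, hU, hUV⟩ := exists_unitary_eig (isHermitian_vHat hV θ)
    refine ⟨U, hU, ?_⟩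
    rw [unitary_conj_pow hU, Matrix.diagonal_pow]
    conv_lhs => rw [hUV]
    congr 3
    funext k
    simp [branch, psqrt_sq]
  · intro k θ _
    exact psqrt_re_im_nonneg _
  · intro k θ hθ
    exact analyticAt_branch (isHermitian_vHat hV) (analyticAt_vHat hV θ) hθ k
  · intro k l
    by_cases hkl : k = l
    · left
      simp [hkl]
    · right
      intro θ hθ h
      exact hkl (((simpleDisc_ne_zero_iff (isHermitian_vHat hV θ)).1 hθ).1 (psqrt_injective h))

/-- The momentum `θ₀` may lie in the exceptional set, but the condition is open and the set null, so
a nearby momentum outside it serves. There each relation coincides locally with a branch. -/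
theorem condE4_of_momentum (hV : V ∈ FiniteRange d n N) {θ₀ : Fin d → ℝ}
    (hd : simpleDisc (vHat V θ₀) ≠ 0) (hh : ∀ k, hessDet (branch (vHat V) k) θ₀ ≠ 0) :
    CondE4 V := by
  intro C w h k
  have h1 := hessCond_isOpen ((coef V : Coef d n N), θ₀)
    (by simpa only [symHat_coef hV, branch_coef hV] using ⟨hd, hh⟩)
  have h2 : ∀ᶠ θ in 𝓝 θ₀, simpleDisc (vHat V θ) ≠ 0 ∧
      ∀ k, hessDet (branch (vHat V) k) θ ≠ 0 := by
    have := (Continuous.prodMk_right (coef V : Coef d n N)).continuousAt.eventually h1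
    simpa only [symHat_coef hV, branch_coef hV] using this
  obtain ⟨θ, hθC, hθd, hθh⟩ := exists_notMem_of_eventually h.null h2
  obtain ⟨σ, -, hσ⟩ := exists_local_permutation hV h hθC hθd
  exact ⟨θ, hθC, by rw [hessDet_congr (hσ k)]; exact hθh _⟩

theorem condE5_of_momentum (hV : V ∈ FiniteRange d n N) {θ₀ : Fin d → ℝ} (i : Fin d)
    (hd : simpleDisc (vHat V θ₀) ≠ 0)
    (hh : ∀ k l, k ≠ l →
      partialDeriv i (branch (vHat V) k) θ₀ - partialDeriv i (branch (vHat V) l) θ₀ ≠ 0 ∧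
      partialDeriv i (branch (vHat V) k) θ₀ + partialDeriv i (branch (vHat V) l) θ₀ ≠ 0) :
    CondE5 V := by
  intro C w h k l hkl c _
  have h1 := gradCond_isOpen i ((coef V : Coef d n N), θ₀)
    (by simpa only [symHat_coef hV, branch_coef hV] using ⟨hd, hh⟩)
  have h2 : ∀ᶠ θ in 𝓝 θ₀, simpleDisc (vHat V θ) ≠ 0 ∧ ∀ k l, k ≠ l →
      partialDeriv i (branch (vHat V) k) θ - partialDeriv i (branch (vHat V) l) θ ≠ 0 ∧
      partialDeriv i (branch (vHat V) k) θ + partialDeriv i (branch (vHat V) l) θ ≠ 0 := by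
    have := (Continuous.prodMk_right (coef V : Coef d n N)).continuousAt.eventually h1
    simpa only [symHat_coef hV, branch_coef hV] using this
  obtain ⟨θ, hθC, hθd, hθh⟩ := exists_notMem_of_eventually h.null h2
  obtain ⟨σ, hσi, hσ⟩ := exists_local_permutation hV h hθC hθd
  -- Distinct relations follow distinct branches, so a constant difference or sum would contradict
  -- the gradient condition.
  obtain ⟨hm, hp⟩ := hθh (σ k) (σ l) (hσi.ne hkl)
  rw [← (partialDeriv_congr (hσ k) i).eq_of_nhds, ← (partialDeriv_congr (hσ l) i).eq_of_nhds]
    at hm hp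
  have hwk := (h.analytic k θ hθC).differentiableAt
  have hwl := (h.analytic l θ hθC).differentiableAt
  have hC := h.isClosed.isOpen_compl.mem_nhds hθC
  have hconst : partialDeriv i (fun _ : Fin d → ℝ => c) θ = 0 := by simp [partialDeriv]
  constructor
  · intro hc
    apply hm
    have : (fun x => w k x - w l x) =ᶠ[𝓝 θ] fun _ => c := by
      filter_upwards [hC] with x hx using hc x hx
    have h3 := (partialDeriv_congr this i).eq_of_nhds
    rw [hconst] at h3
    simpa [partialDeriv, fderiv_fun_sub hwk hwl] using h3
  · intro hc
    apply hp
    have : (fun x => w k x + w l x) =ᶠ[𝓝 θ] fun _ => c := by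
      filter_upwards [hC] with x hx using hc x hx
    have h3 := (partialDeriv_congr this i).eq_of_nhds
    rw [hconst] at h3
    simpa [partialDeriv, fderiv_fun_add hwk hwl] using h3

end Dispersion

/-! ### Explicit perturbations -/

variable {d n N : ℕ}

/-- The interaction `z ↦ c(z) diag(D)`. -/
def diagInteraction (c : (Fin d → ℤ) → ℝ) (D : Fin n → ℝ) : Interaction d n :=
  fun z => c z • Matrix.diagonal D

theorem diagInteraction_mem {c : (Fin d → ℤ) → ℝ} (D : Fin n → ℝ) (heven : ∀ z, c (-z) = c z)
    (hsupp : ∀ z, z ∉ box d N → c z = 0) : diagInteraction c D ∈ FiniteRange d n N := by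
  refine ⟨fun z k l => ?_, fun x hx => ?_⟩
  · by_cases hkl : k = l
    · simp [diagInteraction, heven, hkl]
    · simp [diagInteraction, Matrix.diagonal_apply_ne D hkl,
        Matrix.diagonal_apply_ne D (Ne.symm hkl)]
  · have : x ∉ box d N := by
      obtain ⟨i, hi⟩ := hx
      intro h
      exact absurd (abs_le.2 (Finset.mem_Icc.1 (Fintype.mem_piFinset.1 h i))) (not_le.2 hi)
    simp [diagInteraction, hsupp x this]

theorem vHat_diagInteraction {c : (Fin d → ℤ) → ℝ} {D : Fin n → ℝ}
    (h : diagInteraction c D ∈ FiniteRange d n N) (θ : Fin d → ℝ) :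
    vHat (diagInteraction c D) θ =
      (∑ z ∈ box d N, (c z : ℂ) * wave z θ) • Matrix.diagonal (fun k => (D k : ℂ)) := by
  ext k l
  rw [vHat_apply h, Matrix.smul_apply, smul_eq_mul, Finset.sum_mul]
  refine Finset.sum_congr rfl fun z _ => ?_
  by_cases hkl : k = l
  · simp [diagInteraction, hkl]
    ring
  · simp [diagInteraction, hkl]

theorem zero_mem_box : (0 : Fin d → ℤ) ∈ box d N := by
  simp [box, Fintype.mem_piFinset]

theorem wave_zero (θ : Fin d → ℝ) : wave 0 θ = 1 := by simp [wave]

/-- The eigenvalues of a diagonal matrix with entries `1, …, n` are simple and nonzero. -/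
theorem simpleDisc_diagonal_ne_zero :
    simpleDisc (Matrix.diagonal fun k : Fin n => (((k : ℕ) + 1 : ℝ) : ℂ)) ≠ 0 := by
  have h : (Matrix.of fun i j : Fin n =>
      ((Matrix.diagonal fun k : Fin n => (((k : ℕ) + 1 : ℝ) : ℂ)) ^ ((i : ℕ) + (j : ℕ))).trace) =
      (Matrix.vandermonde (fun k : Fin n => (((k : ℕ) + 1 : ℝ) : ℂ))).transpose *
        Matrix.vandermonde (fun k : Fin n => (((k : ℕ) + 1 : ℝ) : ℂ)) := by
    ext i j
    rw [Matrix.vandermonde_transpose_mul_vandermonde, Matrix.of_apply, Matrix.diagonal_pow,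
      Matrix.trace_diagonal]
    rfl
  rw [simpleDisc, traceDisc, h, Matrix.det_mul, Matrix.det_transpose, mul_ne_zero_iff,
    mul_self_ne_zero, Matrix.det_vandermonde_ne_zero_iff, Matrix.det_diagonal,
    Finset.prod_ne_zero_iff]
  refine ⟨fun k l hkl => ?_, fun k _ => ?_⟩
  · have := Complex.ofReal_injective hkl
    exact Fin.ext (by exact_mod_cast add_right_cancel this)
  · exact Complex.ofReal_ne_zero.2 (by positivity)

/-- The segment starts at `V` and reaches, at `ε = 1`, the constant symbol `diag(1, …, n)`. Along it
`simpleDisc` is analytic in `ε` and nonzero at `1`, so its zeros cannot accumulate at `0`. -/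
theorem exists_simpleDisc_perturbation {V : Interaction d n} (hV : V ∈ FiniteRange d n N)
    (θ : Fin d → ℝ) : ∃ W ∈ FiniteRange d n N,
      ∀ᶠ ε : ℝ in 𝓝[≠] 0, simpleDisc (vHat (V + ε • W) θ) ≠ 0 := by
  let c : (Fin d → ℤ) → ℝ := fun z => if z = 0 then 1 else 0
  let D : Fin n → ℝ := fun k => (k : ℕ) + 1
  have hD : diagInteraction c D ∈ FiniteRange d n N := by
    refine diagInteraction_mem D (fun z => by simp [c]) fun z hz => ?_
    have : z ≠ 0 := fun h => hz (h ▸ zero_mem_box)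
    simp [c, this]
  have hDhat : vHat (diagInteraction c D) θ = Matrix.diagonal fun k => (D k : ℂ) := by
    rw [vHat_diagInteraction hD]
    have : ∑ z ∈ box d N, (c z : ℂ) * wave z θ = 1 := by
      rw [Finset.sum_eq_single_of_mem 0 zero_mem_box fun z _ hz => by simp [c, hz]]
      simp [c, wave_zero]
    rw [this, one_smul]
  have hW : diagInteraction c D + (-1 : ℝ) • V ∈ FiniteRange d n N :=
    add_smul_mem_finiteRange hD hV (-1)
  refine ⟨_, hW, ?_⟩
  have hhat : ∀ ε : ℝ, vHat (V + ε • (diagInteraction c D + (-1 : ℝ) • V)) θ =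
      vHat V θ + (ε : ℂ) • ((Matrix.diagonal fun k => (D k : ℂ)) - vHat V θ) := by
    intro ε
    rw [vHat_add_smul hV hW, vHat_add_smul hD hV, hDhat]
    simp [sub_eq_add_neg]
  refine eventually_ne_zero_of_analytic
    (g := fun ε : ℝ => simpleDisc (vHat (V + ε • (diagInteraction c D + (-1 : ℝ) • V)) θ))
    (s := 1) (fun t => ?_) ?_ 0
  · simp only [hhat]
    refine analyticAt_simpleDisc fun i j => ?_
    simp only [Matrix.add_apply, Matrix.smul_apply, smul_eq_mul]
    exact analyticAt_const.add ((analyticAt_ofReal analyticAt_id).mul analyticAt_const)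
  · rw [hhat, Complex.ofReal_one, one_smul, add_sub_cancel]
    exact simpleDisc_diagonal_ne_zero

/-- The Fourier coefficients of `a - ∑_i cos θ_i`. -/
noncomputable def cosCoef (a : ℝ) (z : Fin d → ℤ) : ℝ :=
  (if z = 0 then a else 0) - (1 / 2) * ∑ i : Fin d,
    ((if z = Pi.single i 1 then 1 else 0) + (if z = -Pi.single i 1 then 1 else 0))

/-- The nearest neighbours carry the cosines; range at least one is what admits them. -/
theorem single_mem_box (hN : 1 ≤ N) (i : Fin d) :
    (Pi.single i 1 : Fin d → ℤ) ∈ box d N ∧ -(Pi.single i 1 : Fin d → ℤ) ∈ box d N := by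
  have hN' : (1 : ℤ) ≤ N := by exact_mod_cast hN
  constructor
  all_goals
    refine Fintype.mem_piFinset.2 fun j => Finset.mem_Icc.2 ?_
    by_cases h : j = i
    · subst h
      simp
      omega
    · simp [h]

theorem cosCoef_mem (hN : 1 ≤ N) (a : ℝ) :
    diagInteraction (cosCoef a) (fun _ => 1) ∈ FiniteRange d n N := by
  refine diagInteraction_mem _ (fun z => ?_) fun z hz => ?_
  · simp only [cosCoef, neg_eq_iff_eq_neg, neg_zero, neg_neg]
    simp only [add_comm]
  · have h0 : z ≠ 0 := fun h => hz (h ▸ zero_mem_box)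
    have h1 : ∀ i, z ≠ Pi.single i 1 := fun i h => hz (h ▸ (single_mem_box hN i).1)
    have h2 : ∀ i, z ≠ -Pi.single i 1 := fun i h => hz (h ▸ (single_mem_box hN i).2)
    simp [cosCoef, h0, h1, h2]

theorem wave_single_add (θ : Fin d → ℝ) (i : Fin d) :
    wave (Pi.single i 1) θ + wave (-Pi.single i 1) θ = 2 * Real.cos (θ i) := by
  have h : ∑ j, (((Pi.single i 1 : Fin d → ℤ) j : ℤ) : ℂ) * (θ j : ℂ) = θ i := by
    rw [Finset.sum_eq_single i]
    · simp
    · intro j _ hj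
      simp [hj]
    · simp
  have h2 : ∑ j, (((-Pi.single i 1 : Fin d → ℤ) j : ℤ) : ℂ) * (θ j : ℂ) = -θ i := by
    rw [← h, ← Finset.sum_neg_distrib]
    simp
  rw [wave, wave, h, h2, Complex.ofReal_cos, Complex.two_cos]
  congr 2 <;> ring

theorem vHat_cosCoef (hN : 1 ≤ N) (a : ℝ) (θ : Fin d → ℝ) :
    vHat (diagInteraction (cosCoef a) (fun _ : Fin n => 1)) θ =
      ((a - ∑ i, Real.cos (θ i) : ℝ) : ℂ) • 1 := by
  rw [vHat_diagInteraction (cosCoef_mem hN a)]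
  have h1 : ∀ z : Fin d → ℤ, (cosCoef a z : ℂ) * wave z θ =
      (if z = 0 then (a : ℂ) * wave z θ else 0) - (1 / 2) * ∑ i : Fin d,
        ((if z = Pi.single i 1 then wave z θ else 0) +
          (if z = -Pi.single i 1 then wave z θ else 0)) := by
    intro z
    simp only [cosCoef, Complex.ofReal_sub, Complex.ofReal_mul, Complex.ofReal_sum,
      Complex.ofReal_add, sub_mul, mul_assoc, Finset.sum_mul, add_mul, apply_ite Complex.ofReal,
      ite_mul, Complex.ofReal_zero, Complex.ofReal_one, zero_mul, one_mul, Complex.ofReal_div,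
      Complex.ofReal_ofNat]
  have h2 : ∑ z ∈ box d N, (cosCoef a z : ℂ) * wave z θ =
      ((a - ∑ i, Real.cos (θ i) : ℝ) : ℂ) := by
    simp only [h1]
    rw [Finset.sum_sub_distrib, ← Finset.mul_sum, Finset.sum_comm, Finset.sum_ite_eq',
      if_pos zero_mem_box, wave_zero]
    simp only [Finset.sum_add_distrib, Finset.sum_ite_eq', (single_mem_box hN _).1,
      (single_mem_box hN _).2, if_true]
    rw [← Finset.sum_add_distrib]
    simp only [wave_single_add]
    rw [← Finset.mul_sum]
    push_cast
    ring
  rw [h2]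
  simp

/-- The shifted eigenvalues are roots of the shifted characteristic polynomial and keep their strict
order, so uniqueness of the ordered enumeration applies. -/
theorem eig_add_smul_one {A : Matrix (Fin n) (Fin n) ℂ} (hA : A.IsHermitian)
    (hinj : Function.Injective (eig A)) (c : ℝ) (k : Fin n) :
    eig (A + (c : ℂ) • 1) k = eig A k + c := by
  obtain ⟨e, he⟩ := exists_equiv_eig_antitone n
  have hH : (A + (c : ℂ) • (1 : Matrix (Fin n) (Fin n) ℂ)).IsHermitian := by
    refine hA.add ?_
    rw [Matrix.IsHermitian, Matrix.conjTranspose_smul, Matrix.conjTranspose_one]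
    simp
  refine congrFun (eig_eq_of_antitone_roots hH (he _) (r := fun k => eig A k + c) ?_ ?_) k
  · intro i j hij
    have := ((he A).strictAnti_of_injective (hinj.comp e.injective)) hij
    simpa using this
  · intro l
    have h1 : A.charpoly.eval (eig A l : ℂ) = 0 := by
      rw [charpoly_eq_prod_eig hA, Polynomial.eval_prod]
      exact Finset.prod_eq_zero (Finset.mem_univ l) (by simp)
    rw [Matrix.eval_charpoly] at h1 ⊢
    rw [← h1]
    congr 1
    rw [Complex.ofReal_add, map_add, Matrix.scalar_apply (c : ℂ),
      ← Matrix.smul_one_eq_diagonal]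
    abel

theorem partialDeriv_cosSum (ε a : ℝ) (j : Fin d) :
    partialDeriv j (fun θ : Fin d → ℝ => ((ε * (a - ∑ i, Real.cos (θ i)) : ℝ) : ℂ)) =
      fun θ => ((ε * Real.sin (θ j) : ℝ) : ℂ) := by
  funext θ
  have h : HasFDerivAt (fun θ : Fin d → ℝ => ε * (a - ∑ i, Real.cos (θ i)))
      (ε • -∑ i, -Real.sin (θ i) • ContinuousLinearMap.proj (R := ℝ) (φ := fun _ : Fin d => ℝ) i)
      θ :=
    ((HasFDerivAt.fun_sum fun i _ => (hasFDerivAt_apply i θ).cos).const_sub a).const_mul ε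
  have h2 := Complex.ofRealCLM.hasFDerivAt.comp θ h
  have h3 : (fun θ : Fin d → ℝ => ((ε * (a - ∑ i, Real.cos (θ i)) : ℝ) : ℂ)) =
    Complex.ofRealCLM ∘ fun θ : Fin d → ℝ => ε * (a - ∑ i, Real.cos (θ i)) := rfl
  rw [partialDeriv, h3, h2.fderiv]
  simp [Pi.single_apply]

theorem partialDeriv_sin (ε : ℝ) (i j : Fin d) (θ : Fin d → ℝ) :
    partialDeriv i (fun θ : Fin d → ℝ => ((ε * Real.sin (θ j) : ℝ) : ℂ)) θ =
      if i = j then ((ε * Real.cos (θ j) : ℝ) : ℂ) else 0 := by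
  have h : HasFDerivAt (fun θ : Fin d → ℝ => ε * Real.sin (θ j))
      (ε • Real.cos (θ j) • ContinuousLinearMap.proj (R := ℝ) (φ := fun _ : Fin d => ℝ) j) θ :=
    ((hasFDerivAt_apply j θ).sin).const_mul ε
  have h2 := Complex.ofRealCLM.hasFDerivAt.comp θ h
  have h3 : (fun θ : Fin d → ℝ => ((ε * Real.sin (θ j) : ℝ) : ℂ)) =
    Complex.ofRealCLM ∘ fun θ : Fin d → ℝ => ε * Real.sin (θ j) := rfl
  rw [partialDeriv, h3, h2.fderiv]
  by_cases hij : i = j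
  · simp [hij]
  · simp [hij, Ne.symm hij]

theorem analyticAt_cosSum (ε a : ℝ) (θ : Fin d → ℝ) :
    AnalyticAt ℝ (fun θ : Fin d → ℝ => ((ε * (a - ∑ i, Real.cos (θ i)) : ℝ) : ℂ)) θ := by
  refine analyticAt_ofReal (analyticAt_const.mul (analyticAt_const.sub
    (Finset.analyticAt_fun_sum _ fun i _ => ?_)))
  exact Real.analyticAt_cos.comp
    ((ContinuousLinearMap.proj (R := ℝ) (φ := fun _ : Fin d => ℝ) i).analyticAt θ)

/-- The perturbation of `V` adding `ε (a - ∑_i cos θ_i)` to all eigenvalues. -/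
noncomputable def cosPerturb (V : Interaction d n) (a ε : ℝ) : Interaction d n :=
  V + ε • diagInteraction (cosCoef a) (fun _ => 1)

theorem cosPerturb_mem {V : Interaction d n} (hN : 1 ≤ N) (hV : V ∈ FiniteRange d n N)
    (a ε : ℝ) : cosPerturb V a ε ∈ FiniteRange d n N :=
  add_smul_mem_finiteRange hV (cosCoef_mem hN a) ε

theorem vHat_cosPerturb {V : Interaction d n} (hN : 1 ≤ N) (hV : V ∈ FiniteRange d n N)
    (a ε : ℝ) (θ : Fin d → ℝ) :
    vHat (cosPerturb V a ε) θ = vHat V θ + ((ε * (a - ∑ i, Real.cos (θ i)) : ℝ) : ℂ) • 1 := by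
  rw [cosPerturb, vHat_add_smul hV (cosCoef_mem hN a), vHat_cosCoef hN, smul_smul,
    ← Complex.ofReal_mul]

theorem vHat_cosPerturb_of_eq {V : Interaction d n} (hN : 1 ≤ N) (hV : V ∈ FiniteRange d n N)
    {a : ℝ} (ε : ℝ) {θ : Fin d → ℝ} (ha : a - ∑ i, Real.cos (θ i) = 0) :
    vHat (cosPerturb V a ε) θ = vHat V θ := by
  rw [vHat_cosPerturb hN hV, ha]
  simp

theorem eventually_branch_cosPerturb {V : Interaction d n} (hN : 1 ≤ N)
    (hV : V ∈ FiniteRange d n N) (a ε : ℝ) {θ : Fin d → ℝ} (hd : simpleDisc (vHat V θ) ≠ 0)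
    (k : Fin n) : ∀ᶠ x in 𝓝 θ,
      branch (vHat (cosPerturb V a ε)) k x * branch (vHat (cosPerturb V a ε)) k x =
        branch (vHat V) k x * branch (vHat V) k x +
          ((ε * (a - ∑ i, Real.cos (x i)) : ℝ) : ℂ) := by
  filter_upwards [(analyticAt_simpleDisc (analyticAt_vHat hV θ)).continuousAt.eventually_ne hd]
    with x hx
  have hH := isHermitian_vHat hV x
  rw [branch, branch, ← pow_two, ← pow_two, psqrt_sq, psqrt_sq, vHat_cosPerturb hN hV,
    eig_add_smul_one hH ((simpleDisc_ne_zero_iff hH).1 hx).1, Complex.ofReal_add]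

theorem branch_ne_zero {V : Interaction d n} (hV : V ∈ FiniteRange d n N) {θ : Fin d → ℝ}
    (hd : simpleDisc (vHat V θ) ≠ 0) (k : Fin n) : branch (vHat V) k θ ≠ 0 :=
  psqrt_ne_zero (((simpleDisc_ne_zero_iff (isHermitian_vHat hV θ)).1 hd).2 k)

/-- At the origin `d - ∑ cos θ_i` vanishes together with its gradient and has identity Hessian. The
Hessian of each branch therefore gains `ε/(2ω_k)` times the identity. -/
theorem eventually_hessDet_cosPerturb {V : Interaction d n} (hN : 1 ≤ N)
    (hV : V ∈ FiniteRange d n N) (hd : simpleDisc (vHat V 0) ≠ 0) :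
    ∀ᶠ ε : ℝ in 𝓝[≠] 0, simpleDisc (vHat (cosPerturb V d ε) 0) ≠ 0 ∧
      ∀ k, hessDet (branch (vHat (cosPerturb V d ε)) k) 0 ≠ 0 := by
  have h0 : (d : ℝ) - ∑ i : Fin d, Real.cos ((0 : Fin d → ℝ) i) = 0 := by simp
  have hz : ∀ k, (2 * branch (vHat V) k 0)⁻¹ ≠ 0 := fun k =>
    inv_ne_zero (mul_ne_zero two_ne_zero (branch_ne_zero hV hd k))
  filter_upwards [eventually_all.2 fun k => eventually_det_add_smul_ne_zero
    (Matrix.of fun i j : Fin d => partialDeriv i (partialDeriv j (branch (vHat V) k)) 0) (hz k)]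
    with ε hε
  have hd' : simpleDisc (vHat (cosPerturb V d ε) 0) ≠ 0 := by
    rwa [vHat_cosPerturb_of_eq hN hV ε h0]
  refine ⟨hd', fun k => ?_⟩
  have hmem := cosPerturb_mem hN hV d ε
  convert hε k
  rw [hessDet]
  congr 1
  ext i j
  rw [Matrix.of_apply, partialDeriv_partialDeriv_perturb
    (analyticAt_branch (isHermitian_vHat hmem) (analyticAt_vHat hmem 0) hd' k)
    (analyticAt_branch (isHermitian_vHat hV) (analyticAt_vHat hV 0) hd k)
    (analyticAt_cosSum ε d 0) (eventually_branch_cosPerturb hN hV d ε hd k)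
    (by simp only [branch, vHat_cosPerturb_of_eq hN hV ε h0]) (branch_ne_zero hV hd k)
    (fun i => by rw [partialDeriv_cosSum]; simp), partialDeriv_cosSum, partialDeriv_sin]
  by_cases hij : i = j
  · simp [hij, div_eq_mul_inv]
  · simp [hij]

/-- At `(π/2, …, π/2)` the function `-∑ cos θ_i` vanishes with all partial derivatives equal to one,
so `∂_i ω_k` gains `ε/(2ω_k)`. Distinct `ω_k²` make the reciprocals neither equal nor opposite; each
difference or sum is affine in `ε` with nonzero slope. -/
theorem eventually_gradCond_cosPerturb {V : Interaction d n} (hN : 1 ≤ N)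
    (hV : V ∈ FiniteRange d n N) (i : Fin d)
    (hd : simpleDisc (vHat V fun _ => Real.pi / 2) ≠ 0) :
    ∀ᶠ ε : ℝ in 𝓝[≠] 0, simpleDisc (vHat (cosPerturb V 0 ε) fun _ => Real.pi / 2) ≠ 0 ∧
      ∀ k l, k ≠ l →
        partialDeriv i (branch (vHat (cosPerturb V 0 ε)) k) (fun _ => Real.pi / 2) -
          partialDeriv i (branch (vHat (cosPerturb V 0 ε)) l) (fun _ => Real.pi / 2) ≠ 0 ∧
        partialDeriv i (branch (vHat (cosPerturb V 0 ε)) k) (fun _ => Real.pi / 2) +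
          partialDeriv i (branch (vHat (cosPerturb V 0 ε)) l) (fun _ => Real.pi / 2) ≠ 0 := by
  set θ : Fin d → ℝ := fun _ => Real.pi / 2 with hθ
  have h0 : (0 : ℝ) - ∑ i : Fin d, Real.cos (θ i) = 0 := by simp [hθ]
  have hH := isHermitian_vHat hV θ
  have hinj := ((simpleDisc_ne_zero_iff hH).1 hd).1
  have hb : ∀ k, branch (vHat V) k θ ≠ 0 := branch_ne_zero hV hd
  have hsq : ∀ k l, k ≠ l → branch (vHat V) k θ ^ 2 ≠ branch (vHat V) l θ ^ 2 := by
    intro k l hkl h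
    rw [branch, branch, psqrt_sq, psqrt_sq] at h
    exact hkl (hinj (Complex.ofReal_injective h))
  have hm : ∀ k l, k ≠ l →
      (2 * branch (vHat V) k θ)⁻¹ - (2 * branch (vHat V) l θ)⁻¹ ≠ 0 := by
    intro k l hkl h
    have := mul_left_cancel₀ two_ne_zero (inv_injective (sub_eq_zero.1 h))
    exact hsq k l hkl (by rw [this])
  have hp : ∀ k l, k ≠ l →
      (2 * branch (vHat V) k θ)⁻¹ + (2 * branch (vHat V) l θ)⁻¹ ≠ 0 := by
    intro k l hkl h
    rw [add_eq_zero_iff_eq_neg, ← inv_neg] at h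
    have h2 := inv_injective h
    rw [← mul_neg] at h2
    exact hsq k l hkl (by rw [mul_left_cancel₀ two_ne_zero h2, neg_sq])
  filter_upwards [eventually_all.2 fun k => eventually_all.2 fun l =>
      eventually_imp_distrib_left.2 fun hkl => eventually_affine_ne_zero
        (partialDeriv i (branch (vHat V) k) θ - partialDeriv i (branch (vHat V) l) θ) (hm k l hkl),
    eventually_all.2 fun k => eventually_all.2 fun l =>
      eventually_imp_distrib_left.2 fun hkl => eventually_affine_ne_zero
        (partialDeriv i (branch (vHat V) k) θ + partialDeriv i (branch (vHat V) l) θ) (hp k l hkl)]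
    with ε hεm hεp
  have hd' : simpleDisc (vHat (cosPerturb V 0 ε) θ) ≠ 0 := by
    rwa [vHat_cosPerturb_of_eq hN hV ε h0]
  have hmem := cosPerturb_mem hN hV 0 ε
  have key : ∀ k, partialDeriv i (branch (vHat (cosPerturb V 0 ε)) k) θ =
      partialDeriv i (branch (vHat V) k) θ + ε * (2 * branch (vHat V) k θ)⁻¹ := by
    intro k
    rw [partialDeriv_perturb_apply
      (analyticAt_branch (isHermitian_vHat hmem) (analyticAt_vHat hmem θ) hd' k)
      (analyticAt_branch (isHermitian_vHat hV) (analyticAt_vHat hV θ) hd k)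
      (analyticAt_cosSum ε 0 θ) (eventually_branch_cosPerturb hN hV 0 ε hd k)
      (by simp only [branch, vHat_cosPerturb_of_eq hN hV ε h0]) (hb k), partialDeriv_cosSum]
    have hs : Real.sin (θ i) = 1 := Real.sin_pi_div_two
    beta_reduce
    rw [hs, mul_one, div_eq_mul_inv]
  refine ⟨hd', fun k l hkl => ⟨?_, ?_⟩⟩
  · convert hεm k l hkl using 1
    rw [key, key]
    ring
  · convert hεp k l hkl using 1
    rw [key, key]
    ring

/-! ### Density and conclusion -/

theorem mem_closure_of_perturbation {S : Set (FiniteRange d n N)} (V : FiniteRange d n N)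
    {W : Interaction d n} (hW : W ∈ FiniteRange d n N)
    (h : ∀ᶠ ε : ℝ in 𝓝[≠] 0, (⟨V.1 + ε • W, add_smul_mem_finiteRange V.2 hW ε⟩ :
      FiniteRange d n N) ∈ S) : V ∈ closure S := by
  have hc : Continuous fun ε : ℝ => (⟨V.1 + ε • W, add_smul_mem_finiteRange V.2 hW ε⟩ :
      FiniteRange d n N) := by
    refine Continuous.subtype_mk ?_ _
    fun_prop
  have ht := (hc.tendsto 0).mono_left (nhdsWithin_le_nhds (s := {0}ᶜ))
  have hV : (⟨V.1 + (0 : ℝ) • W, add_smul_mem_finiteRange V.2 hW 0⟩ : FiniteRange d n N) = V := by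
    ext1
    simp
  rw [hV] at ht
  exact mem_closure_of_tendsto ht h

theorem dense_simpleDisc (θ : Fin d → ℝ) :
    Dense {V : FiniteRange d n N | simpleDisc (vHat V.1 θ) ≠ 0} := fun V => by
  obtain ⟨W, hW, h⟩ := exists_simpleDisc_perturbation V.2 θ
  exact mem_closure_of_perturbation V hW h

/-- Interactions whose ordered branches are regular with nonzero Hessian determinants at some
momentum. -/
def hessRegular (d n N : ℕ) : Set (FiniteRange d n N) :=
  {V | ∃ θ, simpleDisc (vHat V.1 θ) ≠ 0 ∧ ∀ k, hessDet (branch (vHat V.1) k) θ ≠ 0}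

/-- Interactions whose ordered branches are regular, with different `i`-th partial derivatives up to
sign, at some momentum. -/
def gradRegular (n N : ℕ) (i : Fin d) : Set (FiniteRange d n N) :=
  {V | ∃ θ, simpleDisc (vHat V.1 θ) ≠ 0 ∧ ∀ k l, k ≠ l →
    partialDeriv i (branch (vHat V.1) k) θ - partialDeriv i (branch (vHat V.1) l) θ ≠ 0 ∧
    partialDeriv i (branch (vHat V.1) k) θ + partialDeriv i (branch (vHat V.1) l) θ ≠ 0}

theorem isOpen_hessRegular : IsOpen (hessRegular d n N) := by
  convert isOpen_exists_momentum hessCond_isOpen using 1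
  ext V
  simp only [hessRegular, Set.mem_ofPred_eq, symHat_coef V.2, branch_coef V.2]

theorem isOpen_gradRegular (i : Fin d) : IsOpen (gradRegular n N i) := by
  convert isOpen_exists_momentum (gradCond_isOpen i) using 1
  ext V
  simp only [gradRegular, Set.mem_ofPred_eq, symHat_coef V.2, branch_coef V.2]

theorem dense_hessRegular (hN : 1 ≤ N) : Dense (hessRegular d n N) := by
  refine dense_closure.1 ((dense_simpleDisc 0).mono fun V hV => ?_)
  refine mem_closure_of_perturbation V (cosCoef_mem hN d) ?_
  filter_upwards [eventually_hessDet_cosPerturb hN V.2 hV] with ε hε using ⟨0, hε⟩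

theorem dense_gradRegular (hN : 1 ≤ N) (i : Fin d) : Dense (gradRegular n N i) := by
  refine dense_closure.1 ((dense_simpleDisc fun _ => Real.pi / 2).mono fun V hV => ?_)
  refine mem_closure_of_perturbation V (cosCoef_mem hN 0) ?_
  filter_upwards [eventually_gradCond_cosPerturb hN V.2 i hV] with ε hε
    using ⟨fun _ => Real.pi / 2, hε⟩

end HarmonicCrystal

theorem lemma2p3 (d n : ℕ) (hd : 1 ≤ d) (hn : 1 ≤ n) (N : ℕ) (hN : 1 ≤ N) :
    ∃ G : Set (HarmonicCrystal.FiniteRange d n N), IsOpen G ∧ Dense G ∧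
      ∀ V ∈ G,
        (∃ (C : Set (Fin d → ℝ)) (ω : Fin n → (Fin d → ℝ) → ℂ),
          HarmonicCrystal.IsDispersion V.1 C ω) ∧
        HarmonicCrystal.CondE4 V.1 ∧ HarmonicCrystal.CondE5 V.1 := by
  -- A single coordinate direction suffices for E5. The witnessing momenta for E4 and E5 may differ.
  let i : Fin d := ⟨0, hd⟩
  refine ⟨HarmonicCrystal.hessRegular d n N ∩ HarmonicCrystal.gradRegular n N i,
    HarmonicCrystal.isOpen_hessRegular.inter (HarmonicCrystal.isOpen_gradRegular i),
    (HarmonicCrystal.dense_hessRegular hN).inter_of_isOpen_left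
      (HarmonicCrystal.dense_gradRegular hN i) HarmonicCrystal.isOpen_hessRegular, ?_⟩
  rintro V ⟨⟨θ, hd, hh⟩, ⟨θ', hd', hg⟩⟩
  exact ⟨HarmonicCrystal.exists_isDispersion V.2 hd, HarmonicCrystal.condE4_of_momentum V.2 hd hh,
    HarmonicCrystal.condE5_of_momentum V.2 i hd' hg⟩
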